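/- Let $(\mathfrak X,\mathcal X)$ be a measurable space with a measure $\lambda$, let $\Theta\subset\mathbb R^q$ be compact, and let $\{P_\theta\}_{\theta\in\Theta}$ be probability measures on $\mathfrak X$ with densities $p(x\mid\theta)$ with respect to $\lambda$. To make sense of derivatives in $\theta$ at the boundary of $\Theta$, each $p(x\mid\cdot)$ is regarded as a function on a larger domain containing $\Theta$ in its interior. Notation. $\mathcal E_k(\Theta)$ (resp. $\mathcal G_k(\Theta)$) is the set of discrete probability measures on $\Theta$ with exactly (resp. at most) $k$ distinct atoms. For $G=\sum_i p_i\delta_{\theta_i}$ put $P_G=\sum_i p_iP_{\theta_i}$. $V(P,Q)=\sup_{A\in\mathcal X}|P(A)-Q(A)|$ is the total variation distance. $W_r$ is the Wasserstein distance of order $r$ for the Euclidean distance. For integers $m\ge 0$ and $1\le k_0\le k$, the family $\{p(x\mid\theta)\}_{\theta\in\Theta}$ is called $(m,k_0,k)$ linear independent if: 1. for $\lambda$-a.e. $x$, $\theta\mapsto p(x\mid\theta)$ is $m$ times continuously differentiable on $\Theta$ (that is, near each point of $\Theta$, as a function on the larger domain); 2. for every integer $\ell\in[k_0,2k-k_0]$,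 all integers $m_1,\dots,m_\ell$ with $1\le m_i\le m+1$ and $2k_0\le\sum_{i=1}^\ell m_i\le 2k$, all distinct $\theta_1,\dots,\theta_\ell\in\Theta$ and all real coefficients $a_{i\alpha}$ ($1\le i\le\ell$, $\alpha\in\mathbb N^q$, $|\alpha|<m_i$), one has $$\sum_{i=1}^{\ell}\sum_{|\alpha|\le m_i-1}a_{i\alpha}\,\frac{\partial^\alpha p}{\partial\theta^\alpha}(x\mid\theta_i)=0\ \text{ for }\lambda\text{-a.e. }x\quad\text{and}\quad\sum_{i=1}^\ell a_{i\mathbf 0}=0$$ if and only if all $a_{i\alpha}$ vanish. Theorem. Let $k\ge 1$. (a) Let $1\le k_0\le k$ and $d_1=k-k_0+1$. If $\{p(x\mid\theta)\}_{\theta\in\Theta}$ is $(2d_1-1,k_0,k)$ linear independent, then for every $G_0\in\mathcal E_{k_0}(\Theta)$ $$\liminf_{\substack{G,H\to G_0\text{ in }W_1\\ G\ne H\in\mathcal G_k(\Theta)}}\frac{V(P_G,P_H)}{W_{2d_1-1}^{2d_1-1}(G,H)}>0 .$$ (b) If $\{p(x\mid\theta)\}_{\theta\in\Theta}$ is $(2k-1,1,k)$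 linear independent, then for every $k_0\in\{1,\dots,k\}$ the inequality in (a), with $d_1=k-k_0+1$, holds for every $G_0\in\mathcal E_{k_0}(\Theta)$. (The lower limit over an empty set of pairs $G\ne H$ is $+\infty$.) -/

import Mathlib

open MeasureTheory Filter Topology

noncomputable section

/-- Mixing measures: finitely supported probability distributions `∑ i, p i • δ_{θ i}` on `ℝ^q`,
stored through their weight functions `θ ↦ G({θ})`. -/
abbrev MixingMeasure (q : ℕ) : Type := Convexity.StdSimplex ℝ (EuclideanSpace ℝ (Fin q))

/-- `𝓔_k(Θ)`: discrete probability distributions with exactly `k` distinct atoms, all in `Θ`. -/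
def exactlyAtoms {q : ℕ} (Θ : Set (EuclideanSpace ℝ (Fin q))) (k : ℕ) : Set (MixingMeasure q) :=
  {G | (∀ θ ∈ G.weights.support, θ ∈ Θ) ∧ G.weights.support.card = k}

/-- `𝓖_k(Θ)`: discrete probability distributions with at most `k` distinct atoms, all in `Θ`. -/
def atMostAtoms {q : ℕ} (Θ : Set (EuclideanSpace ℝ (Fin q))) (k : ℕ) : Set (MixingMeasure q) :=
  {G | (∀ θ ∈ G.weights.support, θ ∈ Θ) ∧ G.weights.support.card ≤ k}

/-- `w` is a joint distribution on (atoms of `G`) × (atoms of `H`) with marginals `G` and `H`.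
Only the values of `w` at pairs of atoms matter. -/
structure IsCoupling {q : ℕ} (G H : MixingMeasure q)
    (w : EuclideanSpace ℝ (Fin q) → EuclideanSpace ℝ (Fin q) → ℝ) : Prop where
  nonneg : ∀ θ ∈ G.weights.support, ∀ η ∈ H.weights.support, 0 ≤ w θ η
  fst : ∀ θ ∈ G.weights.support, ∑ η ∈ H.weights.support, w θ η = G.weights θ
  snd : ∀ η ∈ H.weights.support, ∑ θ ∈ G.weights.support, w θ η = H.weights η

/-- The transport cost of `w` between `G` and `H` for the `l`-th power of the Euclidean distance. -/
def transportCost {q : ℕ} (l : ℕ) (G H : MixingMeasure q)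
    (w : EuclideanSpace ℝ (Fin q) → EuclideanSpace ℝ (Fin q) → ℝ) : ℝ :=
  ∑ θ ∈ G.weights.support, ∑ η ∈ H.weights.support, w θ η * ‖θ - η‖ ^ l

/-- The Wasserstein distance `W_l(G, H)` of order `l ≥ 1` w.r.t. the Euclidean distance. -/
def wasserstein {q : ℕ} (l : ℕ) (G H : MixingMeasure q) : ℝ :=
  (sInf {c : ℝ | ∃ w, IsCoupling G H w ∧ c = transportCost l G H w}) ^ (1 / (l : ℝ))

/-- The mixture `P_G = ∑ i, p i • P_{θ i}` induced by the mixing measure `G`. -/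
def mixture {q : ℕ} {X : Type*} [MeasurableSpace X] (P : EuclideanSpace ℝ (Fin q) → Measure X)
    (G : MixingMeasure q) : Measure X :=
  ∑ θ ∈ G.weights.support, ENNReal.ofReal (G.weights θ) • P θ

/-- The total variation distance `sup_A |μ(A) - ν(A)|` between probability measures. -/
def totalVariationDist {X : Type*} [MeasurableSpace X] (μ ν : Measure X) : ℝ :=
  ⨆ A : {A : Set X // MeasurableSet A}, |μ.real A - ν.real A|

/-- The multi-indices `α ∈ ℕ^q` with `|α| < n`. -/
def multiIndices (q n : ℕ) : Finset (Fin q → ℕ) :=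
  {α ∈ Fintype.piFinset fun _ : Fin q => Finset.range n | ∑ j, α j < n}

theorem mem_multiIndices {q n : ℕ} {α : Fin q → ℕ} :
    α ∈ multiIndices q n ↔ ∑ j, α j < n := by
  simp only [multiIndices, Finset.mem_filter, Fintype.mem_piFinset, Finset.mem_range,
    and_iff_right_iff_imp]
  intro h j
  exact lt_of_le_of_lt (Finset.single_le_sum (f := α) (fun _ _ => Nat.zero_le _)
    (Finset.mem_univ j)) h

/-- The partial derivative of `f` with respect to the `j`-th coordinate. -/
def partialDeriv {q : ℕ} (j : Fin q) (f : EuclideanSpace ℝ (Fin q) → ℝ) :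
    EuclideanSpace ℝ (Fin q) → ℝ :=
  fun θ => lineDeriv ℝ f θ (EuclideanSpace.single j 1)

/-- `D^α f`: for every `j`, `f` is differentiated `α j` times with respect to coordinate `j`. -/
def multiDeriv {q : ℕ} (α : Fin q → ℕ) (f : EuclideanSpace ℝ (Fin q) → ℝ) :
    EuclideanSpace ℝ (Fin q) → ℝ :=
  (List.finRange q).foldr (fun j g => (partialDeriv j)^[α j] g) f

/-- `(m, k₀, k)` linear independence of the family `{p(x | θ)}`, written `p x θ`, w.r.t. `lam`.
The functions `p x` are defined on all of `ℝ^q`; away from `Θ` they are arbitrary extensions, which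
give a meaning to derivatives at the boundary of `Θ`. -/
structure IsLinIndepFamily {q : ℕ} {X : Type*} [MeasurableSpace X] (lam : Measure X)
    (Θ : Set (EuclideanSpace ℝ (Fin q))) (p : X → EuclideanSpace ℝ (Fin q) → ℝ)
    (m k₀ k : ℕ) : Prop where
  contDiff : ∀ᵐ x ∂lam, ∀ θ ∈ Θ, ContDiffAt ℝ m (p x) θ
  linIndep : ∀ (l : ℕ), k₀ ≤ l → l + k₀ ≤ 2 * k →
    ∀ (mult : Fin l → ℕ), (∀ i, 1 ≤ mult i ∧ mult i ≤ m + 1) →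
      2 * k₀ ≤ ∑ i, mult i → ∑ i, mult i ≤ 2 * k →
    ∀ (θ : Fin l → EuclideanSpace ℝ (Fin q)), Function.Injective θ → (∀ i, θ i ∈ Θ) →
    ∀ (a : Fin l → (Fin q → ℕ) → ℝ),
      ((∀ᵐ x ∂lam, ∑ i, ∑ α ∈ multiIndices q (mult i), a i α * multiDeriv α (p x) (θ i) = 0) ∧
        ∑ i, a i 0 = 0) ↔
      ∀ i, ∀ α ∈ multiIndices q (mult i), a i α = 0

/-- The filter of pairs `(G, H)` of distinct elements of `𝓖_k(Θ)` that both converge to `G₀`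
in the distance `W₁`. -/
def distinctPairsNear {q : ℕ} (Θ : Set (EuclideanSpace ℝ (Fin q))) (k : ℕ)
    (G₀ : MixingMeasure q) : Filter (MixingMeasure q × MixingMeasure q) :=
  comap (fun GH => (wasserstein 1 GH.1 G₀, wasserstein 1 GH.2 G₀)) (𝓝 (0, 0)) ⊓
    𝓟 {GH | GH.1 ∈ atMostAtoms Θ k ∧ GH.2 ∈ atMostAtoms Θ k ∧ GH.1 ≠ GH.2}

/-- The local inverse bound at `G₀`: the lower limit of `V(P_G, P_H) / W_r(G, H)^r`, as distinct
`G, H ∈ 𝓖_k(Θ)` tend to `G₀`, is positive. It is taken in `[-∞, ∞]`. -/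
def LocalInverseBound {q : ℕ} {X : Type*} [MeasurableSpace X]
    (Θ : Set (EuclideanSpace ℝ (Fin q))) (P : EuclideanSpace ℝ (Fin q) → Measure X)
    (k r : ℕ) (G₀ : MixingMeasure q) : Prop :=
  0 < liminf (fun GH : MixingMeasure q × MixingMeasure q =>
    ((totalVariationDist (mixture P GH.1) (mixture P GH.2) / wasserstein r GH.1 GH.2 ^ r : ℝ) :
      EReal)) (distinctPairsNear Θ k G₀)

end

/-! Part (a) is proved by contradiction. Put r = 2d₁ - 1 and suppose that pairs Gₙ ≠ Hₙ converge to
G₀ with V/W_r^r → 0. Padding with atoms of weight zero turns Gₙ - Hₙ into a signed combination of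
exactly 2k point masses with total weight 0, and along a subsequence the 2k points converge. Every
atom of G₀ is a limit both of atoms of Gₙ and of atoms of Hₙ, so it attracts at least two points.
Hence no limit point attracts more than 2k - 2(k₀ - 1) = r + 1 points, and there are between k₀ and
2k - k₀ limit points: exactly the configurations covered by the linear independence hypothesis
(`card_fiber_bounds`).

Let N (`clusterMoments`) be the sum, over the limit points v, of the absolute values of the moments
of the weights around v, of orders less than the number of points attracted by v. Two facts
contradict each other.

First, the L¹ norm of the difference of the densities, divided by N, cannot tend to 0. The moments
divided by N have absolute sum 1, so they subconverge to coefficients that are not all zero. The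
normalised difference converges almost everywhere to the corresponding combination of derivatives of
p, and by Fatou's lemma an L¹ limit 0 would make that combination vanish
(`not_tendsto_of_isLinIndepFamily`).

Second, W_r^r ≤ C·N, so V/W_r^r → 0 would give V/N → 0, while the L¹ norm is at most 2V.

Both facts rest on one inequality (`exists_abs_sum_le_moments`): a combination of at most m + 1
values of a C^m function is bounded by its C^m size times the moments of order at most m. Applied to
the Taylor remainder, it shows that only the Taylor terms survive in the limit. Applied to a bump
function of scale s, whose C^m size is of order s^(-m), it bounds the net weight of every group of
points separated from the others by s. Such bounds at all scales control the cost of a greedy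
transport plan (`exists_plan_cost_le`).

Part (b) follows since its hypothesis contains that of (a) for every k₀. -/

noncomputable section

/-! ### Quantitative C^m bounds and Hadamard's lemma -/

/-- `f` and its iterated partial derivatives up to order `m` are continuous and bounded by `ε`
on `B`. -/
def SmoothBound {q : ℕ} (B : Set (EuclideanSpace ℝ (Fin q))) :
    ℕ → ℝ → (EuclideanSpace ℝ (Fin q) → ℝ) → Prop
  | 0, ε, f => ContinuousOn f B ∧ ∀ y ∈ B, |f y| ≤ ε
  | m + 1, ε, f => (∀ y ∈ B, |f y| ≤ ε) ∧ ∃ g : Fin q → EuclideanSpace ℝ (Fin q) → ℝ,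
      (∀ y ∈ B, HasFDerivAt f
        (∑ j, g j y • (EuclideanSpace.proj j : EuclideanSpace ℝ (Fin q) →L[ℝ] ℝ)) y) ∧
      ∀ j, SmoothBound B m ε (g j)

namespace SmoothBound

variable {q : ℕ} {B : Set (EuclideanSpace ℝ (Fin q))} {m : ℕ} {ε : ℝ}
  {f : EuclideanSpace ℝ (Fin q) → ℝ}

theorem bound (h : SmoothBound B m ε f) {y : EuclideanSpace ℝ (Fin q)} (hy : y ∈ B) :
    |f y| ≤ ε := by
  cases m with
  | zero => exact h.2 y hy
  | succ m => exact h.1 y hy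

theorem continuousOn (h : SmoothBound B m ε f) : ContinuousOn f B := by
  cases m with
  | zero => exact h.1
  | succ m =>
    obtain ⟨-, g, hg, -⟩ := h
    exact fun y hy => (hg y hy).continuousAt.continuousWithinAt

theorem mono {B' : Set (EuclideanSpace ℝ (Fin q))} {ε' : ℝ} (hB : B' ⊆ B) (hε : ε ≤ ε')
    (h : SmoothBound B m ε f) : SmoothBound B' m ε' f := by
  induction m generalizing f with
  | zero => exact ⟨h.1.mono hB, fun y hy => (h.2 y (hB hy)).trans hε⟩
  | succ m ih =>
    obtain ⟨h1, g, hg, hg'⟩ := h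
    exact ⟨fun y hy => (h1 y (hB hy)).trans hε, g, fun y hy => hg y (hB hy), fun j => ih (hg' j)⟩

theorem of_succ (h : SmoothBound B (m + 1) ε f) : SmoothBound B m ε f := by
  induction m generalizing f with
  | zero => exact ⟨h.continuousOn, fun y hy => h.bound hy⟩
  | succ m ih =>
    obtain ⟨h1, g, hg, hg'⟩ := h
    exact ⟨h1, g, hg, fun j => ih (hg' j)⟩

theorem const (c : ℝ) : SmoothBound B m |c| (fun _ => c) := by
  have zero : ∀ (m : ℕ) (ε : ℝ), 0 ≤ ε → SmoothBound B m ε (fun _ => 0) := by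
    intro m ε hε
    induction m with
    | zero => exact ⟨continuousOn_const, fun y _ => by simpa using hε⟩
    | succ m ih =>
      refine ⟨fun y _ => by simpa using hε, fun _ _ => 0, fun y _ => ?_, fun j => ih⟩
      simpa using hasFDerivAt_const (0 : ℝ) y
  cases m with
  | zero => exact ⟨continuousOn_const, fun y _ => le_rfl⟩
  | succ m =>
    refine ⟨fun y _ => le_rfl, fun _ _ => 0, fun y _ => ?_, fun j => zero m _ (abs_nonneg c)⟩
    simpa using hasFDerivAt_const c y

theorem add {δ : ℝ} {g : EuclideanSpace ℝ (Fin q) → ℝ} (hf : SmoothBound B m ε f)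
    (hg : SmoothBound B m δ g) : SmoothBound B m (ε + δ) (fun y => f y + g y) := by
  induction m generalizing f g with
  | zero =>
    exact ⟨hf.1.add hg.1, fun y hy => (abs_add_le _ _).trans (add_le_add (hf.2 y hy) (hg.2 y hy))⟩
  | succ m ih =>
    obtain ⟨hf1, f', hf2, hf3⟩ := hf
    obtain ⟨hg1, g', hg2, hg3⟩ := hg
    refine ⟨fun y hy => (abs_add_le _ _).trans (add_le_add (hf1 y hy) (hg1 y hy)),
      fun j y => f' j y + g' j y, fun y hy => ?_, fun j => ih (hf3 j) (hg3 j)⟩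
    refine ((hf2 y hy).add (hg2 y hy)).congr_fderiv ?_
    simp [add_smul, Finset.sum_add_distrib]

theorem neg (hf : SmoothBound B m ε f) : SmoothBound B m ε (fun y => -f y) := by
  induction m generalizing f with
  | zero => exact ⟨hf.1.neg, fun y hy => by simpa using hf.2 y hy⟩
  | succ m ih =>
    obtain ⟨hf1, f', hf2, hf3⟩ := hf
    refine ⟨fun y hy => by simpa using hf1 y hy, fun j y => -f' j y, fun y hy => ?_,
      fun j => ih (hf3 j)⟩
    refine (hf2 y hy).neg.congr_fderiv ?_
    simp

/-- The Leibniz rule yields two products per differentiation, so each order doubles the bound; this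
is the factor `2 ^ m`. -/
theorem mul {δ : ℝ} {g : EuclideanSpace ℝ (Fin q) → ℝ} (hε : 0 ≤ ε) (hδ : 0 ≤ δ)
    (hf : SmoothBound B m ε f) (hg : SmoothBound B m δ g) :
    SmoothBound B m (2 ^ m * (ε * δ)) (fun y => f y * g y) := by
  have hb : ∀ y ∈ B, |f y * g y| ≤ ε * δ := fun y hy => by
    rw [abs_mul]
    exact mul_le_mul (hf.bound hy) (hg.bound hy) (abs_nonneg _) hε
  induction m generalizing f g with
  | zero => exact ⟨hf.1.mul hg.1, fun y hy => by simpa using hb y hy⟩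
  | succ m ih =>
    have hf0 := hf.of_succ
    have hg0 := hg.of_succ
    obtain ⟨hf1, f', hf2, hf3⟩ := hf
    obtain ⟨hg1, g', hg2, hg3⟩ := hg
    refine ⟨fun y hy => (hb y hy).trans ?_,
      fun j y => f y * g' j y + f' j y * g y, fun y hy => ?_, fun j => ?_⟩
    · exact le_mul_of_one_le_left (by positivity) (one_le_pow₀ (by norm_num))
    · refine ((hf2 y hy).mul (hg2 y hy)).congr_fderiv ?_
      simp [add_smul, Finset.sum_add_distrib, Finset.smul_sum, mul_smul, mul_comm]
    · have h1 := ih hf0 (hg3 j) fun y hy => by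
        rw [abs_mul]
        exact mul_le_mul (hf0.bound hy) ((hg3 j).bound hy) (abs_nonneg _) hε
      have h2 := ih (hf3 j) hg0 fun y hy => by
        rw [abs_mul]
        exact mul_le_mul ((hf3 j).bound hy) (hg0.bound hy) (abs_nonneg _) hε
      exact (h1.add h2).mono subset_rfl (by rw [pow_succ]; linarith)

/-- Averages of dilations towards a point of a convex set keep the bounds. -/
theorem average (hB : IsOpen B) (hc : Convex ℝ B) {z : EuclideanSpace ℝ (Fin q)} (hz : z ∈ B)
    (hf : SmoothBound B m ε f) (n : ℕ) :
    SmoothBound B m ε (fun y => ∫ t in (0 : ℝ)..1, t ^ n * f (z + t • (y - z))) := by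
  have hseg : ∀ y ∈ B, ∀ t : ℝ, t ∈ Set.Icc (0 : ℝ) 1 → z + t • (y - z) ∈ B := fun y hy t ht =>
    hc.add_smul_sub_mem hz hy ht
  have hI : Set.uIoc (0 : ℝ) 1 ⊆ Set.Icc 0 1 := by
    rw [Set.uIoc_of_le zero_le_one]
    exact Set.Ioc_subset_Icc_self
  have hcont : ∀ {φ : EuclideanSpace ℝ (Fin q) → ℝ}, ContinuousOn φ B → ∀ k : ℕ, ∀ y ∈ B,
      ContinuousOn (fun t : ℝ => t ^ k * φ (z + t • (y - z))) (Set.Icc 0 1) := by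
    intro φ hφ k y hy
    refine (continuous_pow k).continuousOn.mul (hφ.comp (by fun_prop) fun t ht => hseg y hy t ht)
  have hpt : ∀ {φ : EuclideanSpace ℝ (Fin q) → ℝ}, (∀ y ∈ B, |φ y| ≤ ε) → ∀ k : ℕ, ∀ y ∈ B,
      ∀ t ∈ Set.Icc (0 : ℝ) 1, |t ^ k * φ (z + t • (y - z))| ≤ ε := by
    intro φ hφ k y hy t ht
    rw [abs_mul, abs_pow, abs_of_nonneg ht.1]
    have h1 := hφ _ (hseg y hy t ht)
    have h2 : t ^ k ≤ 1 := pow_le_one₀ ht.1 ht.2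
    have h3 : 0 ≤ t ^ k := pow_nonneg ht.1 k
    nlinarith [abs_nonneg (φ (z + t • (y - z)))]
  have hbd : ∀ y ∈ B, |∫ t in (0 : ℝ)..1, t ^ n * f (z + t • (y - z))| ≤ ε := by
    intro y hy
    have := intervalIntegral.norm_integral_le_of_norm_le_const (a := 0) (b := 1) (C := ε)
      (f := fun t => t ^ n * f (z + t • (y - z))) fun t ht =>
        hpt (fun y hy => hf.bound hy) n y hy t (hI ht)
    simpa using this
  induction m generalizing f n with
  | zero =>
    refine ⟨fun y hy => ContinuousAt.continuousWithinAt ?_, hbd⟩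
    refine intervalIntegral.continuousAt_of_dominated_interval (bound := fun _ => ε) ?_ ?_
      intervalIntegrable_const ?_
    · filter_upwards [hB.mem_nhds hy] with y hy
      exact ((hcont hf.1 n y hy).mono hI).aestronglyMeasurable measurableSet_uIoc
    · filter_upwards [hB.mem_nhds hy] with y hy
      exact ae_of_all _ fun t ht => hpt hf.2 n y hy t (hI ht)
    · refine ae_of_all _ fun t ht => ?_
      have h1 : ContinuousAt f (z + t • (y - z)) :=
        hf.1.continuousAt (hB.mem_nhds (hseg y hy t (hI ht)))
      exact continuousAt_const.mul (ContinuousAt.comp (f := fun y => z + t • (y - z)) h1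
        (by fun_prop))
  | succ m ih =>
    have hfc := hf.continuousOn
    obtain ⟨hf1, g, hf2, hf3⟩ := hf
    have hbg : ∀ k : ℕ, ∀ j, ∀ y ∈ B,
        |∫ t in (0 : ℝ)..1, t ^ k * g j (z + t • (y - z))| ≤ ε := by
      intro k j y hy
      have := intervalIntegral.norm_integral_le_of_norm_le_const (a := 0) (b := 1) (C := ε)
        (f := fun t => t ^ k * g j (z + t • (y - z))) fun t ht =>
          hpt (fun y hy => (hf3 j).bound hy) k y hy t (hI ht)
      simpa using this
    -- Differentiating in `y` brings out one factor `t`. The induction therefore runs over all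
    -- weights `t ^ n`, which are at most 1 and so do not enlarge the bound.
    refine ⟨hbd, fun j y => ∫ t in (0 : ℝ)..1, t ^ (n + 1) * g j (z + t • (y - z)),
      fun y hy => ?_, fun j => ih (hf3 j) (n + 1) (hbg (n + 1) j)⟩
    have key := intervalIntegral.hasFDerivAt_integral_of_dominated_of_fderiv_le
      (μ := volume) (a := 0) (b := 1) (s := B) (x₀ := y) (𝕜 := ℝ)
      (F := fun y t => t ^ n * f (z + t • (y - z)))
      (F' := fun y t => ∑ j, (t ^ (n + 1) * g j (z + t • (y - z))) •
        (EuclideanSpace.proj j : EuclideanSpace ℝ (Fin q) →L[ℝ] ℝ))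
      (bound := fun _ => ∑ j : Fin q, ε *
        ‖(EuclideanSpace.proj j : EuclideanSpace ℝ (Fin q) →L[ℝ] ℝ)‖)
      (hB.mem_nhds hy) ?_ ?_ ?_ ?_ intervalIntegrable_const ?_
    · refine key.congr_fderiv ?_
      rw [intervalIntegral.integral_finsetSum]
      · refine Finset.sum_congr rfl fun j _ => ?_
        rw [intervalIntegral.integral_smul_const]
      · intro j _
        refine ContinuousOn.intervalIntegrable ?_
        rw [Set.uIcc_of_le zero_le_one]
        exact (hcont (hf3 j).continuousOn (n + 1) y hy).smul continuousOn_const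
    · filter_upwards [hB.mem_nhds hy] with y hy
      exact ((hcont hfc n y hy).mono hI).aestronglyMeasurable measurableSet_uIoc
    · refine ContinuousOn.intervalIntegrable ?_
      rw [Set.uIcc_of_le zero_le_one]
      exact hcont hfc n y hy
    · refine ContinuousOn.aestronglyMeasurable ?_ measurableSet_uIoc
      refine ContinuousOn.mono ?_ hI
      exact continuousOn_finsetSum _ fun j _ =>
        (hcont (hf3 j).continuousOn (n + 1) y hy).smul continuousOn_const
    · refine ae_of_all _ fun t ht y hy => ?_
      refine (norm_sum_le _ _).trans (Finset.sum_le_sum fun j _ => ?_)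
      rw [norm_smul]
      exact mul_le_mul_of_nonneg_right
        (hpt (fun y hy => (hf3 j).bound hy) (n + 1) y hy t (hI ht)) (norm_nonneg _)
    · refine ae_of_all _ fun t ht y hy => ?_
      have h1 := hf2 _ (hseg y hy t (hI ht))
      have h2 : HasFDerivAt (fun y : EuclideanSpace ℝ (Fin q) => z + t • (y - z))
          (t • ContinuousLinearMap.id ℝ (EuclideanSpace ℝ (Fin q))) y :=
        (((hasFDerivAt_id y).sub_const z).const_smul t).const_add z
      refine ((h1.comp y h2).const_mul (t ^ n)).congr_fderiv ?_
      ext v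
      simp [Finset.mul_sum, pow_succ]
      refine Finset.sum_congr rfl fun j _ => by ring

/-- Hadamard's lemma. -/
theorem exists_hadamard (hB : IsOpen B) (hc : Convex ℝ B) {z : EuclideanSpace ℝ (Fin q)}
    (hz : z ∈ B) (hf : SmoothBound B (m + 1) ε f) :
    ∃ h : Fin q → EuclideanSpace ℝ (Fin q) → ℝ, (∀ j, SmoothBound B m ε (h j)) ∧
      ∀ y ∈ B, f y = f z + ∑ j, (y j - z j) * h j y := by
  obtain ⟨-, g, hf2, hf3⟩ := hf
  -- The factor `t ^ 0` is there only to match the form of `average`.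
  refine ⟨fun j y => ∫ t in (0 : ℝ)..1, t ^ 0 * g j (z + t • (y - z)),
    fun j => (hf3 j).average hB hc hz 0, fun y hy => ?_⟩
  have hseg : ∀ t : ℝ, t ∈ Set.uIcc (0 : ℝ) 1 → z + t • (y - z) ∈ B := fun t ht =>
    hc.add_smul_sub_mem hz hy (by rwa [Set.uIcc_of_le zero_le_one] at ht)
  have hcont : ∀ j, ContinuousOn (fun t : ℝ => g j (z + t • (y - z))) (Set.uIcc 0 1) := fun j =>
    (hf3 j).continuousOn.comp (by fun_prop) hseg
  have hd : ∀ t ∈ Set.uIcc (0 : ℝ) 1, HasDerivAt (fun t : ℝ => f (z + t • (y - z)))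
      (∑ j, (y j - z j) * g j (z + t • (y - z))) t := by
    intro t ht
    have h2 : HasDerivAt (fun t : ℝ => z + t • (y - z)) (y - z) t := by
      simpa using ((hasDerivAt_id t).smul_const (y - z)).const_add z
    refine ((hf2 _ (hseg t ht)).comp_hasDerivAt t h2).congr_deriv ?_
    simp [mul_comm]
  have key := intervalIntegral.integral_eq_sub_of_hasDerivAt hd
    (ContinuousOn.intervalIntegrable (continuousOn_finsetSum _ fun j _ =>
      continuousOn_const.mul (hcont j)))
  rw [intervalIntegral.integral_finsetSum (f := fun j t => (y j - z j) * g j (z + t • (y - z)))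
    fun j _ => (continuousOn_const.mul (hcont j)).intervalIntegrable] at key
  simp only [intervalIntegral.integral_const_mul] at key
  simp only [pow_zero, one_mul, key]
  simp

end SmoothBound

/-! ### Point evaluations bounded by moments -/

/-- The monomial `(y - c)^α`. -/
def shiftedMonomial {q : ℕ} (c : EuclideanSpace ℝ (Fin q)) (α : Fin q → ℕ)
    (y : EuclideanSpace ℝ (Fin q)) : ℝ :=
  ∏ j, (y j - c j) ^ α j

theorem shiftedMonomial_add_single {q : ℕ} (c y : EuclideanSpace ℝ (Fin q)) (α : Fin q → ℕ)
    (j : Fin q) :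
    shiftedMonomial c (α + Pi.single j 1) y = shiftedMonomial c α y * (y j - c j) := by
  simp only [shiftedMonomial, Pi.add_apply, pow_add, Finset.prod_mul_distrib]
  congr 1
  rw [Finset.prod_eq_single j]
  · simp
  · intro i _ hi
    simp [Pi.single_eq_of_ne hi]
  · simp

theorem add_single_mem_multiIndices {q m : ℕ} {α : Fin q → ℕ} (j : Fin q) :
    α + Pi.single j 1 ∈ multiIndices q (m + 1) ↔ α ∈ multiIndices q m := by
  simp [mem_multiIndices, Finset.sum_add_distrib]

theorem multiIndices_mono {q m n : ℕ} (h : m ≤ n) : multiIndices q m ⊆ multiIndices q n := by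
  intro α hα
  rw [mem_multiIndices] at hα ⊢
  omega

/-- A combination of at most `m + 1` point evaluations of a `C^m` function is controlled by the
moments of order at most `m` of the combination. -/
theorem exists_abs_sum_le_moments (q m : ℕ) : ∃ C : ℝ, 0 ≤ C ∧
    ∀ (B : Set (EuclideanSpace ℝ (Fin q))), IsOpen B → Convex ℝ B →
    ∀ (ε : ℝ) (f : EuclideanSpace ℝ (Fin q) → ℝ), SmoothBound B m ε f →
    ∀ (c : EuclideanSpace ℝ (Fin q)) {ι : Type} (s : Finset ι), s.card ≤ m + 1 →
    ∀ (z : ι → EuclideanSpace ℝ (Fin q)), (∀ i ∈ s, z i ∈ B ∧ ∀ j, |z i j - c j| ≤ 1) →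
    ∀ w : ι → ℝ, |∑ i ∈ s, w i * f (z i)| ≤
      C * ε * ∑ α ∈ multiIndices q (m + 1), |∑ i ∈ s, w i * shiftedMonomial c α (z i)| := by
  classical
  induction m with
  | zero =>
    refine ⟨1, zero_le_one, fun B hB hc ε f hf c ι s hs z hz w => ?_⟩
    rcases s.eq_empty_or_nonempty with rfl | hne
    · simp
    · obtain ⟨a, rfl⟩ := Finset.card_eq_one.1 (le_antisymm hs hne.card_pos)
      have hz' := hz a (by simp)
      have h0 : multiIndices q (0 + 1) = {0} := by
        ext α
        simp [mem_multiIndices, funext_iff]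
      simp only [h0, Finset.sum_singleton, shiftedMonomial, Pi.zero_apply, pow_zero,
        Finset.prod_const_one, one_mul, abs_mul, abs_one, mul_one]
      rw [mul_comm]
      exact mul_le_mul_of_nonneg_right (hf.bound hz'.1) (abs_nonneg _)
  | succ m ih =>
    obtain ⟨C, hC, ih⟩ := ih
    refine ⟨1 + q * (C * 2), by positivity, fun B hB hc ε f hf c ι s hs z hz w => ?_⟩
    rcases s.eq_empty_or_nonempty with rfl | ⟨a, ha⟩
    · simp
    have hza := hz a ha
    have hε : 0 ≤ ε := (abs_nonneg _).trans (hf.bound hza.1)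
    -- Expanding around one of the points, `z a`, trades one derivative for one point: the factors
    -- `y j - z a j` vanish at `z a`, so the combinations of the `h j` involve only `s.erase a`.
    obtain ⟨h, hh, hfh⟩ := hf.exists_hadamard hB hc hza.1
    set A : (Fin q → ℕ) → ℝ := fun α => ∑ i ∈ s, w i * shiftedMonomial c α (z i) with hA
    have hsplit : ∑ i ∈ s, w i * f (z i) = f (z a) * A 0 +
        ∑ j, ∑ i ∈ s.erase a, (w i * (z i j - z a j)) * h j (z i) := by
      have h1 : ∑ i ∈ s, w i * f (z i) =
          ∑ i ∈ s, (f (z a) * w i + ∑ j, (w i * (z i j - z a j)) * h j (z i)) := by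
        refine Finset.sum_congr rfl fun i hi => ?_
        rw [hfh _ (hz i hi).1, mul_add, Finset.mul_sum]
        congr 1
        · ring
        · exact Finset.sum_congr rfl fun j _ => by ring
      rw [h1, Finset.sum_add_distrib, ← Finset.mul_sum, Finset.sum_comm]
      congr 1
      · simp [hA, shiftedMonomial]
      · refine Finset.sum_congr rfl fun j _ => ?_
        rw [← Finset.add_sum_erase _ _ ha]
        simp
    have hA0 : |A 0| ≤ ∑ α ∈ multiIndices q (m + 1 + 1), |A α| :=
      Finset.single_le_sum (f := fun α => |A α|) (fun _ _ => abs_nonneg _)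
        (mem_multiIndices.2 (by simp))
    have hj : ∀ j, |∑ i ∈ s.erase a, (w i * (z i j - z a j)) * h j (z i)| ≤
        C * ε * (2 * ∑ α ∈ multiIndices q (m + 1 + 1), |A α|) := by
      intro j
      refine (ih B hB hc ε (h j) (hh j) c (s.erase a)
        (by rw [Finset.card_erase_of_mem ha]; omega) z
        (fun i hi => hz i (Finset.mem_of_mem_erase hi)) _).trans ?_
      refine mul_le_mul_of_nonneg_left ?_ (by positivity)
      -- The moments of the new weights `w i * (z i j - z a j)` are differences of old moments, of
      -- order at most one higher. The coefficient `z a j - c j` is at most 1 in absolute value,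
      -- which accounts for the factor 2 in the constant.
      have hmom : ∀ α, ∑ i ∈ s.erase a, w i * (z i j - z a j) * shiftedMonomial c α (z i) =
          A (α + Pi.single j 1) - (z a j - c j) * A α := by
        intro α
        have : ∑ i ∈ s.erase a, w i * (z i j - z a j) * shiftedMonomial c α (z i) =
            ∑ i ∈ s, w i * (z i j - z a j) * shiftedMonomial c α (z i) := by
          rw [← Finset.add_sum_erase s _ ha]
          simp
        rw [this, hA]
        simp only [shiftedMonomial_add_single, Finset.mul_sum, ← Finset.sum_sub_distrib]
        exact Finset.sum_congr rfl fun i _ => by ring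
      calc _ ≤ ∑ α ∈ multiIndices q (m + 1), (|A (α + Pi.single j 1)| + |A α|) := by
            refine Finset.sum_le_sum fun α _ => ?_
            rw [hmom]
            refine (abs_sub _ _).trans (add_le_add le_rfl ?_)
            rw [abs_mul]
            exact mul_le_of_le_one_left (abs_nonneg _) (hza.2 j)
        _ = ∑ α ∈ multiIndices q (m + 1), |A (α + Pi.single j 1)| +
            ∑ α ∈ multiIndices q (m + 1), |A α| := Finset.sum_add_distrib
        _ ≤ _ := by
            rw [two_mul]
            refine add_le_add ?_ (Finset.sum_le_sum_of_subset_of_nonneg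
              (multiIndices_mono (Nat.le_succ _)) fun _ _ _ => abs_nonneg _)
            rw [← Finset.sum_image (f := fun α => |A α|) (s := multiIndices q (m + 1))
              (g := fun α => α + Pi.single j 1) (fun α _ β _ hαβ => add_right_cancel hαβ)]
            refine Finset.sum_le_sum_of_subset_of_nonneg ?_ fun _ _ _ => abs_nonneg _
            intro β hβ
            obtain ⟨α, hα, rfl⟩ := Finset.mem_image.1 hβ
            exact (add_single_mem_multiIndices j).2 hα
    rw [hsplit]
    calc _ ≤ |f (z a) * A 0| + ∑ j, |∑ i ∈ s.erase a, (w i * (z i j - z a j)) * h j (z i)| :=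
          (abs_add_le _ _).trans (add_le_add le_rfl (Finset.abs_sum_le_sum_abs _ _))
      _ ≤ ε * ∑ α ∈ multiIndices q (m + 1 + 1), |A α| +
          ∑ j : Fin q, C * ε * (2 * ∑ α ∈ multiIndices q (m + 1 + 1), |A α|) := by
          refine add_le_add ?_ (Finset.sum_le_sum fun j _ => hj j)
          rw [abs_mul]
          exact mul_le_mul (hf.bound hza.1) hA0 (abs_nonneg _) hε
      _ = _ := by
          simp
          ring


/-! ### Iterated partial derivatives and their order -/

section PartialDerivatives

variable {q : ℕ} {f g : EuclideanSpace ℝ (Fin q) → ℝ} {c : EuclideanSpace ℝ (Fin q)}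

theorem Filter.EventuallyEq.partialDeriv (h : f =ᶠ[𝓝 c] g) (j : Fin q) :
    partialDeriv j f =ᶠ[𝓝 c] partialDeriv j g := by
  filter_upwards [h.eventuallyEq_nhds] with y hy
  exact hy.lineDeriv_eq

theorem ContDiffAt.partialDeriv_eventuallyEq {m : ℕ} (hf : ContDiffAt ℝ (m + 1 : ℕ) f c)
    (j : Fin q) :
    partialDeriv j f =ᶠ[𝓝 c] fun y => fderiv ℝ f y (EuclideanSpace.single j 1) := by
  filter_upwards [hf.eventually (by simp)] with y hy
  exact (hy.differentiableAt (by simp)).lineDeriv_eq_fderiv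

theorem ContDiffAt.partialDeriv {m : ℕ} (hf : ContDiffAt ℝ (m + 1 : ℕ) f c) (j : Fin q) :
    ContDiffAt ℝ m (partialDeriv j f) c := by
  refine ContDiffAt.congr_of_eventuallyEq ?_ (hf.partialDeriv_eventuallyEq j)
  exact (hf.fderiv_right (m := (m : ℕ)) (by simp)).clm_apply contDiffAt_const

/-- Both sides are values of the second Fréchet derivative, which is symmetric. Equality is needed
near `c` and not only at `c`, so that it can be differentiated further. -/
theorem ContDiffAt.partialDeriv_comm (hf : ContDiffAt ℝ (2 : ℕ) f c) (i j : Fin q) :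
    _root_.partialDeriv i (_root_.partialDeriv j f) =ᶠ[𝓝 c]
      _root_.partialDeriv j (_root_.partialDeriv i f) := by
  have key : ∀ y, ContDiffAt ℝ (2 : ℕ) f y → ∀ i j : Fin q,
      _root_.partialDeriv i (_root_.partialDeriv j f) y = fderiv ℝ (fderiv ℝ f) y
        (EuclideanSpace.single i 1) (EuclideanSpace.single j 1) := by
    intro y hy i j
    have hy1 : ContDiffAt ℝ (1 + 1 : ℕ) f y := hy
    have h1 := ((hy1.partialDeriv_eventuallyEq j).partialDeriv i).self_of_nhds
    rw [h1]
    have hd : DifferentiableAt ℝ (fderiv ℝ f) y :=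
      (hy.fderiv_right (m := 1) (by norm_num)).differentiableAt (by simp)
    have h2 : HasFDerivAt (fun y => fderiv ℝ f y (EuclideanSpace.single j 1))
        ((fderiv ℝ (fderiv ℝ f) y).flip (EuclideanSpace.single j 1)) y := by
      refine (hd.hasFDerivAt.clm_apply
        (hasFDerivAt_const (EuclideanSpace.single j (1 : ℝ)) y)).congr_fderiv ?_
      simp
    exact (h2.differentiableAt.lineDeriv_eq_fderiv).trans (by rw [h2.fderiv]; rfl)
  filter_upwards [hf.eventually (by simp)] with y hy
  rw [key y hy, key y hy]
  exact (hy.isSymmSndFDerivAt (by simp)).eq _ _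

theorem DifferentiableAt.hasFDerivAt_sum_partialDeriv (hf : DifferentiableAt ℝ f c) :
    HasFDerivAt f (∑ j, _root_.partialDeriv j f c •
      (EuclideanSpace.proj j : EuclideanSpace ℝ (Fin q) →L[ℝ] ℝ)) c := by
  refine hf.hasFDerivAt.congr_fderiv ?_
  ext v
  have hv : v = ∑ j, v j • EuclideanSpace.single j (1 : ℝ) := by
    ext i
    simp [Finset.sum_apply, Pi.single_apply]
  conv_lhs => rw [hv]
  simp [_root_.partialDeriv, hf.lineDeriv_eq_fderiv, mul_comm]

/-- The iterated partial derivative along a list of coordinates. -/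
def wordDeriv (w : List (Fin q)) (f : EuclideanSpace ℝ (Fin q) → ℝ) :
    EuclideanSpace ℝ (Fin q) → ℝ :=
  w.foldr (fun j g => partialDeriv j g) f

theorem ContDiffAt.wordDeriv {m : ℕ} (w : List (Fin q)) (hf : ContDiffAt ℝ (m + w.length : ℕ) f c) :
    ContDiffAt ℝ m (wordDeriv w f) c := by
  induction w generalizing m with
  | nil => exact hf
  | cons j w ih =>
    refine ContDiffAt.partialDeriv (ih ?_) j
    rwa [List.length_cons, add_comm w.length, ← add_assoc] at hf

theorem List.Perm.wordDeriv_eventuallyEq {w w' : List (Fin q)} (h : w.Perm w')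
    (hf : ContDiffAt ℝ w.length f c) : wordDeriv w f =ᶠ[𝓝 c] wordDeriv w' f := by
  induction h with
  | nil => rfl
  | cons j _ ih => exact (ih (hf.of_le (by simp))).partialDeriv j
  | swap i j w =>
    refine ContDiffAt.partialDeriv_comm (ContDiffAt.wordDeriv w ?_) j i
    exact hf.of_le (by simp only [List.length_cons]; norm_cast; omega)
  | trans h1 _ ih1 ih2 => exact (ih1 hf).trans (ih2 (by rwa [← h1.length_eq]))

/-- A list of coordinates in which `j` occurs `α j` times. -/
def multiIndexWord (α : Fin q → ℕ) : List (Fin q) :=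
  (List.finRange q).flatMap fun j => List.replicate (α j) j

theorem multiDeriv_eq_wordDeriv (α : Fin q → ℕ) (f : EuclideanSpace ℝ (Fin q) → ℝ) :
    multiDeriv α f = wordDeriv (multiIndexWord α) f := by
  have hrep : ∀ (n : ℕ) (j : Fin q) (g : EuclideanSpace ℝ (Fin q) → ℝ),
      (List.replicate n j).foldr (fun j g => partialDeriv j g) g = (partialDeriv j)^[n] g := by
    intro n j g
    induction n with
    | zero => rfl
    | succ n ih => rw [List.replicate_succ, List.foldr_cons, ih, Function.iterate_succ_apply']
  rw [multiDeriv, wordDeriv, multiIndexWord, List.foldr_flatMap]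
  simp only [hrep]

theorem count_multiIndexWord (α : Fin q → ℕ) (j : Fin q) : (multiIndexWord α).count j = α j := by
  rw [multiIndexWord, List.count_flatMap]
  have : (List.count j ∘ fun i => List.replicate (α i) i) = fun i => if i = j then α i else 0 := by
    funext i
    simp [List.count_replicate]
  rw [this, ← Fin.sum_univ_def]
  simp

theorem length_multiIndexWord (α : Fin q → ℕ) : (multiIndexWord α).length = ∑ j, α j := by
  simp [multiIndexWord, List.length_flatMap, Fin.sum_univ_def]

/-- `multiDeriv` differentiates in a fixed order of the coordinates, and an innermost derivative in
direction `j` breaks this order. The two words of coordinates are permutations of each other, hence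
give the same derivative. -/
theorem multiDeriv_partialDeriv {m : ℕ} {α : Fin q → ℕ} (hα : α ∈ multiIndices q m)
    (hf : ContDiffAt ℝ m f c) (j : Fin q) :
    multiDeriv α (partialDeriv j f) c = multiDeriv (α + Pi.single j 1) f c := by
  have h1 : wordDeriv (multiIndexWord α) (partialDeriv j f) =
      wordDeriv (multiIndexWord α ++ [j]) f := by
    simp [wordDeriv]
  rw [multiDeriv_eq_wordDeriv, multiDeriv_eq_wordDeriv, h1]
  refine (List.Perm.wordDeriv_eventuallyEq ?_ (hf.of_le ?_)).self_of_nhds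
  · rw [List.perm_iff_count]
    intro i
    rw [List.count_append, count_multiIndexWord, count_multiIndexWord, Pi.add_apply]
    rcases eq_or_ne i j with rfl | h
    · simp
    · simp [h.symm]
  · rw [List.length_append, length_multiIndexWord]
    rw [mem_multiIndices] at hα
    norm_cast

end PartialDerivatives

/-! ### Taylor polynomials and remainders -/

/-- `α! = ∏ j, (α j)!`. -/
def multiFactorial {q : ℕ} (α : Fin q → ℕ) : ℝ := ∏ j, ((α j).factorial : ℝ)

theorem multiFactorial_pos {q : ℕ} (α : Fin q → ℕ) : 0 < multiFactorial α :=
  Finset.prod_pos fun j _ => by exact_mod_cast (α j).factorial_pos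

theorem multiFactorial_add_single {q : ℕ} (α : Fin q → ℕ) (j : Fin q) :
    multiFactorial (α + Pi.single j 1) = (α j + 1) * multiFactorial α := by
  rw [multiFactorial, multiFactorial, ← Finset.mul_prod_erase _ _ (Finset.mem_univ j),
    ← Finset.mul_prod_erase (a := j) _ (fun j => ((α j).factorial : ℝ)) (Finset.mem_univ j)]
  have : ∏ x ∈ Finset.univ.erase j, (((α + Pi.single j 1 : Fin q → ℕ) x).factorial : ℝ) =
      ∏ x ∈ Finset.univ.erase j, ((α x).factorial : ℝ) :=
    Finset.prod_congr rfl fun i hi => by simp [Pi.single_eq_of_ne (Finset.ne_of_mem_erase hi)]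
  rw [this]
  simp [Nat.factorial_succ]
  ring

/-- If `α j = 0`, the truncated subtraction leaves `α` unchanged, but the factor `α j` removes the
term. -/
theorem hasFDerivAt_shiftedMonomial {q : ℕ} (c : EuclideanSpace ℝ (Fin q)) (α : Fin q → ℕ)
    (y : EuclideanSpace ℝ (Fin q)) :
    HasFDerivAt (shiftedMonomial c α) (∑ j, (α j * shiftedMonomial c (α - Pi.single j 1) y) •
      (EuclideanSpace.proj j : EuclideanSpace ℝ (Fin q) →L[ℝ] ℝ)) y := by
  have h1 : ∀ j ∈ (Finset.univ : Finset (Fin q)),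
      HasFDerivAt (fun y : EuclideanSpace ℝ (Fin q) => (y j - c j) ^ α j)
      ((α j * (y j - c j) ^ (α j - 1)) •
        (EuclideanSpace.proj j : EuclideanSpace ℝ (Fin q) →L[ℝ] ℝ)) y := by
    intro j _
    have h2 : HasFDerivAt (fun y : EuclideanSpace ℝ (Fin q) => y j - c j)
        (EuclideanSpace.proj j : EuclideanSpace ℝ (Fin q) →L[ℝ] ℝ) y :=
      ((EuclideanSpace.proj j : EuclideanSpace ℝ (Fin q) →L[ℝ] ℝ).hasFDerivAt).sub_const _
    refine (h2.pow (α j)).congr_fderiv ?_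
    simp
  refine (HasFDerivAt.finsetProd h1).congr_fderiv ?_
  refine Finset.sum_congr rfl fun j _ => ?_
  rw [smul_smul]
  congr 1
  rw [shiftedMonomial, ← Finset.mul_prod_erase _ _ (Finset.mem_univ j)]
  have : ∏ x ∈ Finset.univ.erase j, (y x - c x) ^ ((α - Pi.single j 1 : Fin q → ℕ) x) =
      ∏ x ∈ Finset.univ.erase j, (y x - c x) ^ α x :=
    Finset.prod_congr rfl fun i hi => by simp [Pi.single_eq_of_ne (Finset.ne_of_mem_erase hi)]
  rw [this]
  simp
  ring

/-- The Taylor polynomial of degree `m` of `f` at `c`. -/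
def taylorPolynomial {q : ℕ} (m : ℕ) (f : EuclideanSpace ℝ (Fin q) → ℝ)
    (c y : EuclideanSpace ℝ (Fin q)) : ℝ :=
  ∑ α ∈ multiIndices q (m + 1), multiDeriv α f c / multiFactorial α * shiftedMonomial c α y

theorem taylorPolynomial_self {q : ℕ} (m : ℕ) (f : EuclideanSpace ℝ (Fin q) → ℝ)
    (c : EuclideanSpace ℝ (Fin q)) : taylorPolynomial m f c c = f c := by
  rw [taylorPolynomial, Finset.sum_eq_single 0]
  · have : ∀ l : List (Fin q),
        l.foldr (fun j g => (partialDeriv j)^[(0 : Fin q → ℕ) j] g) f = f := by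
      intro l
      induction l with
      | nil => rfl
      | cons j l ih => rw [List.foldr_cons, ih]; rfl
    rw [multiDeriv, this]
    simp [multiFactorial, shiftedMonomial]
  · intro α _ hα
    obtain ⟨j, hj⟩ := Function.ne_iff.1 hα
    rw [shiftedMonomial, Finset.prod_eq_zero (Finset.mem_univ j), mul_zero]
    simpa using hj
  · intro h
    exact (h (mem_multiIndices.2 (by simp))).elim

theorem sum_multiIndices_succ_of_eq_zero {q m : ℕ} (j : Fin q) (F : (Fin q → ℕ) → ℝ)
    (hF : ∀ α, α j = 0 → F α = 0) :
    ∑ α ∈ multiIndices q (m + 1), F α = ∑ α ∈ multiIndices q m, F (α + Pi.single j 1) := by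
  rw [← Finset.sum_image (s := multiIndices q m) (f := F) (g := fun α => α + Pi.single j 1)
    (fun α _ β _ hαβ => add_right_cancel hαβ)]
  symm
  refine Finset.sum_subset ?_ fun α hα hα' => ?_
  · intro β hβ
    obtain ⟨α, hα, rfl⟩ := Finset.mem_image.1 hβ
    exact (add_single_mem_multiIndices j).2 hα
  · refine hF α ?_
    by_contra hj
    have h3 : α - Pi.single j 1 + Pi.single j 1 = α := by
      refine tsub_add_cancel_of_le fun i => ?_
      rcases eq_or_ne i j with rfl | hi
      · simp
        omega
      · simp [Pi.single_eq_of_ne hi]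
    refine hα' (Finset.mem_image.2 ⟨α - Pi.single j 1, ?_, h3⟩)
    rwa [← add_single_mem_multiIndices j, h3]

/-- Taking Taylor polynomials commutes with partial derivatives, with a loss of one degree.
Derivatives of a Taylor remainder are therefore Taylor remainders again, which permits induction on
the order. -/
theorem hasFDerivAt_taylorPolynomial {q m : ℕ} {f : EuclideanSpace ℝ (Fin q) → ℝ}
    {c : EuclideanSpace ℝ (Fin q)} (hf : ContDiffAt ℝ (m + 1 : ℕ) f c)
    (y : EuclideanSpace ℝ (Fin q)) :
    HasFDerivAt (taylorPolynomial (m + 1) f c) (∑ j, taylorPolynomial m (partialDeriv j f) c y •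
      (EuclideanSpace.proj j : EuclideanSpace ℝ (Fin q) →L[ℝ] ℝ)) y := by
  have h := HasFDerivAt.fun_sum (u := multiIndices q (m + 1 + 1)) fun α _ =>
    (hasFDerivAt_shiftedMonomial c α y).const_mul (multiDeriv α f c / multiFactorial α)
  refine h.congr_fderiv ?_
  simp only [Finset.smul_sum, smul_smul]
  rw [Finset.sum_comm]
  refine Finset.sum_congr rfl fun j _ => ?_
  rw [← Finset.sum_smul]
  congr 1
  rw [sum_multiIndices_succ_of_eq_zero j _ fun α hα => by simp [hα], taylorPolynomial]
  refine Finset.sum_congr rfl fun α hα => ?_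
  rw [multiDeriv_partialDeriv hα hf j, multiFactorial_add_single, add_tsub_cancel_right]
  have := (multiFactorial_pos α).ne'
  have h2 : ((α j : ℝ) + 1) ≠ 0 := by positivity
  simp only [Pi.add_apply, Pi.single_eq_same, Nat.cast_add, Nat.cast_one]
  field_simp

theorem continuous_shiftedMonomial {q : ℕ} (c : EuclideanSpace ℝ (Fin q)) (α : Fin q → ℕ) :
    Continuous (shiftedMonomial c α) := by
  unfold shiftedMonomial
  fun_prop

theorem continuous_taylorPolynomial {q : ℕ} (m : ℕ) (f : EuclideanSpace ℝ (Fin q) → ℝ)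
    (c : EuclideanSpace ℝ (Fin q)) : Continuous (taylorPolynomial m f c) :=
  continuous_finsetSum _ fun α _ => continuous_const.mul (continuous_shiftedMonomial c α)

/-- The Taylor remainder of order `m` of a `C^m` function is locally small in `C^m`. -/
theorem exists_smoothBound_sub_taylorPolynomial {q m : ℕ} {f : EuclideanSpace ℝ (Fin q) → ℝ}
    {c : EuclideanSpace ℝ (Fin q)} (hf : ContDiffAt ℝ m f c) {ε : ℝ} (hε : 0 < ε) :
    ∃ δ > 0, SmoothBound (Metric.ball c δ) m ε fun y => f y - taylorPolynomial m f c y := by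
  -- The remainder is continuous at `c` and vanishes there. The same argument applies to each
  -- `partialDeriv j f` in the induction.
  have hsmall : ∀ᶠ y in 𝓝 c, |f y - taylorPolynomial m f c y| ≤ ε := by
    have h1 : Tendsto (fun y => f y - taylorPolynomial m f c y) (𝓝 c)
        (𝓝 (f c - taylorPolynomial m f c c)) :=
      (hf.continuousAt.sub (continuous_taylorPolynomial m f c).continuousAt).tendsto
    rw [taylorPolynomial_self, sub_self] at h1
    filter_upwards [h1.eventually (Metric.closedBall_mem_nhds 0 hε)] with y hy
    simpa using hy
  induction m generalizing f with
  | zero =>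
    obtain ⟨u, hu, hfu⟩ := contDiffAt_zero.1 (by simpa using hf)
    obtain ⟨δ, hδ, hδ'⟩ := Metric.nhds_basis_ball.eventually_iff.1 (hsmall.and hu)
    exact ⟨δ, hδ, (hfu.mono fun y hy => (hδ' hy).2).sub
      (continuous_taylorPolynomial 0 f c).continuousOn, fun y hy => (hδ' hy).1⟩
  | succ m ih =>
    have hj : ∀ j, ∃ δ > 0, SmoothBound (Metric.ball c δ) m ε
        fun y => partialDeriv j f y - taylorPolynomial m (partialDeriv j f) c y := by
      intro j
      refine ih (hf.partialDeriv j) ?_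
      have h1 : Tendsto (fun y => partialDeriv j f y - taylorPolynomial m (partialDeriv j f) c y)
          (𝓝 c) (𝓝 (partialDeriv j f c - taylorPolynomial m (partialDeriv j f) c c)) :=
        ((hf.partialDeriv j).continuousAt.sub
          (continuous_taylorPolynomial m _ c).continuousAt).tendsto
      rw [taylorPolynomial_self, sub_self] at h1
      filter_upwards [h1.eventually (Metric.closedBall_mem_nhds 0 hε)] with y hy
      simpa using hy
    choose δ hδ hS using hj
    have hdiff : ∀ᶠ y in 𝓝 c, HasFDerivAt f (∑ j, partialDeriv j f y •
        (EuclideanSpace.proj j : EuclideanSpace ℝ (Fin q) →L[ℝ] ℝ)) y := by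
      filter_upwards [hf.eventually (by simp)] with y hy
      exact (hy.differentiableAt (by simp)).hasFDerivAt_sum_partialDeriv
    obtain ⟨δ', hδ', hb⟩ := Metric.nhds_basis_ball.eventually_iff.1 (hsmall.and (hdiff.and
      (eventually_all.2 fun j => Metric.ball_mem_nhds c (hδ j))))
    refine ⟨δ', hδ', fun y hy => (hb hy).1, fun j y => partialDeriv j f y -
      taylorPolynomial m (partialDeriv j f) c y, fun y hy => ?_, fun j =>
      (hS j).mono (fun y hy => (hb hy).2.2 j) le_rfl⟩
    refine ((hb hy).2.1.sub (hasFDerivAt_taylorPolynomial hf y)).congr_fderiv ?_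
    simp [sub_smul, Finset.sum_sub_distrib]

/-- Combinations of at most `m + 1` evaluations near `c` are given by their moments up to an error
which is small relative to the moments. -/
theorem eventually_abs_sum_sub_moments_le {q m : ℕ} {f : EuclideanSpace ℝ (Fin q) → ℝ}
    {c : EuclideanSpace ℝ (Fin q)} (hf : ContDiffAt ℝ m f c) {ε : ℝ} (hε : 0 < ε) :
    ∃ δ > 0, ∀ {ι : Type} (s : Finset ι), s.card ≤ m + 1 →
    ∀ (z : ι → EuclideanSpace ℝ (Fin q)), (∀ i ∈ s, dist (z i) c < δ) → ∀ w : ι → ℝ,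
      |∑ i ∈ s, w i * f (z i) - ∑ α ∈ multiIndices q (m + 1),
        multiDeriv α f c / multiFactorial α * ∑ i ∈ s, w i * shiftedMonomial c α (z i)| ≤
      ε * ∑ α ∈ multiIndices q (m + 1), |∑ i ∈ s, w i * shiftedMonomial c α (z i)| := by
  obtain ⟨C, hC, hCb⟩ := exists_abs_sum_le_moments q m
  -- The moment inequality is applied to the Taylor remainder, so its constant `C` has to be
  -- absorbed; `C + 1` avoids division by zero.
  obtain ⟨δ, hδ, hS⟩ := exists_smoothBound_sub_taylorPolynomial hf
    (ε := ε / (C + 1)) (by positivity)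
  refine ⟨min δ 1, lt_min hδ one_pos, fun s hs z hz w => ?_⟩
  have h := hCb _ Metric.isOpen_ball (convex_ball c δ) _ _ hS c s hs z (fun i hi =>
    ⟨(hz i hi).trans_le (min_le_left _ _), fun j => ?_⟩) w
  · have h1 : ∑ i ∈ s, w i * (f (z i) - taylorPolynomial m f c (z i)) =
        ∑ i ∈ s, w i * f (z i) - ∑ α ∈ multiIndices q (m + 1),
        multiDeriv α f c / multiFactorial α * ∑ i ∈ s, w i * shiftedMonomial c α (z i) := by
      simp only [mul_sub, Finset.sum_sub_distrib, taylorPolynomial, Finset.mul_sum]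
      rw [Finset.sum_comm]
      congr 1
      exact Finset.sum_congr rfl fun α _ => Finset.sum_congr rfl fun i _ => by ring
    rw [h1] at h
    refine h.trans (mul_le_mul_of_nonneg_right ?_ (Finset.sum_nonneg fun _ _ => abs_nonneg _))
    rw [mul_div_assoc', div_le_iff₀ (by positivity)]
    nlinarith
  · have h2 := PiLp.norm_apply_le (z i - c) j
    rw [← dist_eq_norm] at h2
    simpa using h2.trans ((hz i hi).trans_le (min_le_right _ _)).le


/-! ### Rescaled bump functions and the weight of separated groups -/

namespace SmoothBound

variable {q : ℕ} {m : ℕ} {ε : ℝ} {f : EuclideanSpace ℝ (Fin q) → ℝ}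

theorem comp_sub (hf : SmoothBound Set.univ m ε f) (a : EuclideanSpace ℝ (Fin q)) :
    SmoothBound Set.univ m ε (fun y => f (y - a)) := by
  induction m generalizing f with
  | zero =>
    exact ⟨hf.1.comp (by fun_prop) fun _ _ => Set.mem_univ _, fun y _ => hf.2 _ (Set.mem_univ _)⟩
  | succ m ih =>
    obtain ⟨hf1, g, hf2, hf3⟩ := hf
    refine ⟨fun y _ => hf1 _ (Set.mem_univ _), fun j y => g j (y - a), fun y _ => ?_,
      fun j => ih (hf3 j)⟩
    exact (hf2 (y - a) (Set.mem_univ _)).comp y ((hasFDerivAt_id y).sub_const a)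

/-- Every derivative costs a factor `s⁻¹`. At most `m` of them are taken, so `s ^ m` compensates
when `s ≤ 1`. -/
theorem comp_inv_smul {s : ℝ} (hs : 0 < s) (hs1 : s ≤ 1) (hf : SmoothBound Set.univ m ε f) :
    SmoothBound Set.univ m ε (fun y => s ^ m * f (s⁻¹ • y)) := by
  have hb : ∀ y ∈ Set.univ, |s ^ m * f (s⁻¹ • y)| ≤ ε := by
    intro y _
    rw [abs_mul, abs_of_nonneg (by positivity)]
    exact (mul_le_of_le_one_left (abs_nonneg _) (pow_le_one₀ hs.le hs1)).trans
      (hf.bound (Set.mem_univ _))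
  induction m generalizing f with
  | zero =>
    exact ⟨continuousOn_const.mul (hf.1.comp (by fun_prop) fun _ _ => Set.mem_univ _), hb⟩
  | succ m ih =>
    obtain ⟨hf1, g, hf2, hf3⟩ := hf
    refine ⟨hb, fun j y => s ^ m * g j (s⁻¹ • y), fun y _ => ?_, fun j => ih (hf3 j) ?_⟩
    · have h2 : HasFDerivAt (fun y : EuclideanSpace ℝ (Fin q) => s⁻¹ • y)
          (s⁻¹ • ContinuousLinearMap.id ℝ (EuclideanSpace ℝ (Fin q))) y :=
        (hasFDerivAt_id y).const_smul s⁻¹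
      refine (((hf2 (s⁻¹ • y) (Set.mem_univ _)).comp y h2).const_mul (s ^ (m + 1))).congr_fderiv ?_
      ext v
      simp [Finset.mul_sum]
      refine Finset.sum_congr rfl fun j _ => ?_
      field_simp
      ring
    · intro y _
      rw [abs_mul, abs_of_nonneg (by positivity)]
      exact (mul_le_of_le_one_left (abs_nonneg _) (pow_le_one₀ hs.le hs1)).trans
        ((hf3 j).bound (Set.mem_univ _))

theorem prod {κ : Type*} (U : Finset κ) {g : κ → EuclideanSpace ℝ (Fin q) → ℝ} (hε : 0 ≤ ε)
    (hg : ∀ u ∈ U, SmoothBound Set.univ m ε (g u)) :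
    SmoothBound Set.univ m ((2 ^ m * ε) ^ U.card) (fun y => ∏ u ∈ U, g u y) := by
  classical
  induction U using Finset.induction_on with
  | empty => simpa using SmoothBound.const (m := m) (B := Set.univ) (1 : ℝ)
  | insert a U ha ih =>
    have h := SmoothBound.mul hε (by positivity) (hg a (Finset.mem_insert_self _ _))
      (ih fun u hu => hg u (Finset.mem_insert_of_mem hu))
    simp only [Finset.prod_insert ha, Finset.card_insert_of_notMem ha]
    exact h.mono subset_rfl (by rw [pow_succ]; exact le_of_eq (by ring))

theorem exists_of_contDiff (hf : ContDiff ℝ (⊤ : ℕ∞) f) (hs : HasCompactSupport f) (m : ℕ) :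
    ∃ C : ℝ, SmoothBound Set.univ m C f := by
  induction m generalizing f with
  | zero =>
    obtain ⟨C, hC⟩ := hf.continuous.bounded_above_of_compact_support hs
    exact ⟨C, hf.continuous.continuousOn, fun y _ => hC y⟩
  | succ m ih =>
    obtain ⟨C, hC⟩ := hf.continuous.bounded_above_of_compact_support hs
    have hd : Differentiable ℝ f := hf.differentiable (by simp)
    have hp : ∀ j, partialDeriv j f = fun y => fderiv ℝ f y (EuclideanSpace.single j 1) :=
      fun j => funext fun y => (hd y).lineDeriv_eq_fderiv
    have hj : ∀ j, ∃ C, SmoothBound Set.univ m C (partialDeriv j f) := by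
      intro j
      rw [hp]
      exact ih ((hf.fderiv_right (m := (⊤ : ℕ∞)) (by simp)).clm_apply contDiff_const)
        (hs.fderiv_apply (𝕜 := ℝ) _)
    choose D hD using hj
    refine ⟨|C| + ∑ j, |D j|, fun y _ => (hC y).trans ?_, fun j => partialDeriv j f,
      fun y _ => (hd y).hasFDerivAt_sum_partialDeriv, fun j => (hD j).mono subset_rfl ?_⟩
    · exact (le_abs_self C).trans (le_add_of_nonneg_right (Finset.sum_nonneg fun _ _ => abs_nonneg _))
    · exact (le_abs_self _).trans ((Finset.single_le_sum (f := fun j => |D j|)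
        (fun _ _ => abs_nonneg _) (Finset.mem_univ j)).trans (le_add_of_nonneg_left (abs_nonneg _)))

end SmoothBound

/-- The total weight of a group of points at distance at least `s` from the other points is
controlled by the moments. -/
theorem exists_pow_mul_abs_sum_le_moments (q m n : ℕ) : ∃ C : ℝ, 0 ≤ C ∧
    ∀ (c : EuclideanSpace ℝ (Fin q)) {ι : Type} (t : Finset ι), t.card ≤ m + 1 →
    ∀ (z : ι → EuclideanSpace ℝ (Fin q)), (∀ i ∈ t, ∀ j, |z i j - c j| ≤ 1) →
    ∀ (s : ℝ), 0 < s → s ≤ 1 → ∀ (U : Finset (EuclideanSpace ℝ (Fin q))), U.card ≤ n →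
    (∀ i ∈ t, z i ∉ U → ∀ u ∈ U, s ≤ dist (z i) u) → ∀ w : ι → ℝ,
      s ^ m * |∑ i ∈ t, w i * Set.indicator (U : Set (EuclideanSpace ℝ (Fin q))) 1 (z i)| ≤
        C * ∑ α ∈ multiIndices q (m + 1), |∑ i ∈ t, w i * shiftedMonomial c α (z i)| := by
  classical
  obtain ⟨C, hC, hCb⟩ := exists_abs_sum_le_moments q m
  let φ : ContDiffBump (0 : EuclideanSpace ℝ (Fin q)) :=
    ⟨1 / 2, 1, by norm_num, by norm_num⟩
  obtain ⟨D₀, hD₀⟩ := SmoothBound.exists_of_contDiff (f := φ) φ.contDiff φ.hasCompactSupport m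
  have hD₀0 : 0 ≤ D₀ := (abs_nonneg _).trans (hD₀.bound (Set.mem_univ 0))
  refine ⟨C * (1 + (2 ^ m * (1 + D₀)) ^ n), by positivity,
    fun c ι t ht z hz s hs hs1 U hU hsep w => ?_⟩
  -- At the points rescaled by `s⁻¹`, this function is 1 on the group `U`, where some factor
  -- vanishes, and 0 at points of distance at least `s` from `U`, where all bumps vanish. Its C^m
  -- size depends on `U` only through the bound `n` on the number of factors.
  set F : EuclideanSpace ℝ (Fin q) → ℝ := fun y => 1 + -∏ u ∈ U, (1 + -φ (y - s⁻¹ • u)) with hF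
  have hFs : SmoothBound Set.univ m (1 + (2 ^ m * (1 + D₀)) ^ n) F := by
    have h1 := SmoothBound.const (m := m) (B := (Set.univ : Set (EuclideanSpace ℝ (Fin q)))) 1
    rw [abs_one] at h1
    have h2 := SmoothBound.prod U (g := fun u y => 1 + -φ (y - s⁻¹ • u)) (ε := 1 + D₀)
      (by positivity) fun u _ => h1.add (hD₀.comp_sub (s⁻¹ • u)).neg
    refine (h1.add h2.neg).mono subset_rfl (add_le_add le_rfl ?_)
    exact pow_le_pow_right₀ (one_le_mul_of_one_le_of_one_le (one_le_pow₀ (by norm_num))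
      (by linarith)) hU
  have hFz : ∀ i ∈ t, F (s⁻¹ • z i) = Set.indicator (U : Set (EuclideanSpace ℝ (Fin q))) 1 (z i) := by
    intro i hi
    by_cases hiU : z i ∈ U
    · rw [Set.indicator_of_mem (by exact_mod_cast hiU), hF]
      simp only
      rw [Finset.prod_eq_zero hiU]
      · simp
      · rw [sub_self, φ.one_of_mem_closedBall (by simp [φ.rIn_pos.le])]
        simp
    · rw [Set.indicator_of_notMem (by exact_mod_cast hiU), hF]
      simp only
      rw [Finset.prod_eq_one]
      · simp
      · intro u hu
        rw [φ.zero_of_le_dist]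
        · simp
        · show (1 : ℝ) ≤ _
          rw [dist_zero_right, ← smul_sub, norm_smul, ← dist_eq_norm, norm_inv,
            Real.norm_of_nonneg hs.le, ← div_eq_inv_mul, one_le_div hs]
          exact hsep i hi hiU u hu
  have h := hCb Set.univ isOpen_univ convex_univ _ _ (hFs.comp_inv_smul hs hs1) c t ht z
    (fun i hi => ⟨Set.mem_univ _, hz i hi⟩) w
  refine le_of_eq_of_le ?_ h
  rw [← abs_of_nonneg (pow_nonneg hs.le m), ← abs_mul, abs_of_nonneg (pow_nonneg hs.le m),
    Finset.mul_sum]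
  congr 1
  refine Finset.sum_congr rfl fun i hi => ?_
  rw [hFz i hi]
  ring


/-! ### Transport plans on finite metric spaces -/

/-- The greedy plan between `g` and `h`, which serves the pairs in increasing order of `ρ`: for every
pair, one of its two points is exhausted by pairs of no larger `ρ`. -/
theorem exists_greedy_plan {α : Type*} [DecidableEq α] (A B : Finset α) (ρ : α × α → ℝ)
    (L : Finset (α × α)) : L ⊆ A ×ˢ B → ∀ g h : α → ℝ, (∀ a, 0 ≤ g a) → (∀ b, 0 ≤ h b) →
    ∃ w : α → α → ℝ, (∀ a b, 0 ≤ w a b) ∧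
      (∀ a ∈ A, ∑ b ∈ B, w a b ≤ g a) ∧ (∀ b ∈ B, ∑ a ∈ A, w a b ≤ h b) ∧
      ∀ p ∈ L, g p.1 ≤ ∑ b ∈ B with ρ (p.1, b) ≤ ρ p, w p.1 b ∨
        h p.2 ≤ ∑ a ∈ A with ρ (a, p.2) ≤ ρ p, w a p.2 := by
  induction L using Finset.induction_on_min_value ρ with
  | empty =>
    intro _ g h hg hh
    exact ⟨fun _ _ => 0, fun _ _ => le_rfl, fun a _ => by simpa using hg a,
      fun b _ => by simpa using hh b, by simp⟩
  | insert p L hp hmin ih =>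
    intro hL g h hg hh
    obtain ⟨hpA, hpB⟩ := Finset.mem_product.1 (hL (Finset.mem_insert_self p L))
    -- The cheapest pair is served first, with as much mass as possible, which exhausts one of its
    -- two points. The remaining pairs share the residual masses.
    set m := min (g p.1) (h p.2) with hm
    have hm0 : 0 ≤ m := le_min (hg _) (hh _)
    obtain ⟨w, hw0, hwA, hwB, hst⟩ := ih ((Finset.subset_insert p L).trans hL)
      (fun a => g a - if a = p.1 then m else 0) (fun b => h b - if b = p.2 then m else 0)
      (fun a => by
        split_ifs with ha
        · rw [ha]; exact sub_nonneg.2 (min_le_left _ _)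
        · simpa using hg a)
      (fun b => by
        split_ifs with hb
        · rw [hb]; exact sub_nonneg.2 (min_le_right _ _)
        · simpa using hh b)
    have hrow : ∀ (S : Finset α) (a : α), ∑ b ∈ S, (w a b + if a = p.1 ∧ b = p.2 then m else 0) =
        ∑ b ∈ S, w a b + if a = p.1 ∧ p.2 ∈ S then m else 0 := by
      intro S a
      rw [Finset.sum_add_distrib]
      congr 1
      by_cases ha : a = p.1 <;> simp [ha]
    have hcol : ∀ (S : Finset α) (b : α), ∑ a ∈ S, (w a b + if a = p.1 ∧ b = p.2 then m else 0) =
        ∑ a ∈ S, w a b + if b = p.2 ∧ p.1 ∈ S then m else 0 := by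
      intro S b
      rw [Finset.sum_add_distrib]
      congr 1
      by_cases hb : b = p.2 <;> simp [hb]
    refine ⟨fun a b => w a b + if a = p.1 ∧ b = p.2 then m else 0, fun a b => ?_, fun a ha => ?_,
      fun b hb => ?_, fun x hx => ?_⟩
    · have := hw0 a b
      show 0 ≤ w a b + if a = p.1 ∧ b = p.2 then m else 0
      split_ifs <;> linarith
    · have := hwA a ha
      rw [hrow]
      simp only [hpB, and_true]
      linarith
    · have := hwB b hb
      rw [hcol]
      simp only [hpA, and_true]
      linarith
    · rw [hrow, hcol]
      rcases Finset.mem_insert.1 hx with rfl | hx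
      · simp only [Finset.mem_filter, hpA, hpB, le_refl, and_self, if_true]
        rcases min_choice (g x.1) (h x.2) with hc | hc
        · left
          rw [hm, hc]
          exact le_add_of_nonneg_left (Finset.sum_nonneg fun _ _ => hw0 _ _)
        · right
          rw [hm, hc]
          exact le_add_of_nonneg_left (Finset.sum_nonneg fun _ _ => hw0 _ _)
      · have hle := hmin x hx
        rcases hst x hx with h1 | h1
        · left
          -- The mass `m` missing from the residual is restored by the pair `p`, which counts
          -- because `ρ p ≤ ρ x`.
          by_cases ha : x.1 = p.1
          · have : ρ (x.1, p.2) ≤ ρ x := by rw [ha]; exact hle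
            simp only [ha, if_true] at h1 ⊢
            simp only [ha] at this
            simp only [Finset.mem_filter, hpB, this, and_self, if_true]
            linarith
          · simp only [ha, if_false, false_and] at h1 ⊢
            linarith
        · right
          by_cases hb : x.2 = p.2
          · have : ρ (p.1, x.2) ≤ ρ x := by rw [hb]; exact hle
            simp only [hb, if_true] at h1 ⊢
            simp only [hb] at this
            simp only [Finset.mem_filter, hpA, this, and_self, if_true]
            linarith
          · simp only [hb, if_false, false_and] at h1 ⊢
            linarith

/-- Around a point of a finite set of at most `n` points there is a group of radius less than `n * s`
which has distance at least `s` to the other points. -/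
theorem exists_separated_group {α : Type*} [MetricSpace α] (S : Finset α) {n : ℕ}
    (hS : S.card ≤ n) {a : α} (ha : a ∈ S) {s : ℝ} (hs : 0 < s) :
    ∃ U ⊆ S, a ∈ U ∧ (∀ u ∈ U, dist u a < n * s) ∧ ∀ x ∈ S, x ∉ U → ∀ u ∈ U, s ≤ dist x u := by
  classical
  -- Pigeonhole: at most `n` points cannot meet all of the `n + 1` shells of width `s` around `a`.
  -- The ball inside an empty shell is the group, and the shell is the gap.
  obtain ⟨j, hj, hj'⟩ : ∃ j ∈ Finset.range (n + 1), j ∉ S.image fun x => ⌊dist x a / s⌋₊ := by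
    by_contra! hcon
    have := Finset.card_le_card hcon
    rw [Finset.card_range] at this
    have := Finset.card_image_le (s := S) (f := fun x => ⌊dist x a / s⌋₊)
    omega
  have hj0 : 0 < j := by
    rcases Nat.eq_zero_or_pos j with rfl | h
    · exact (hj' (Finset.mem_image.2 ⟨a, ha, by simp⟩)).elim
    · exact h
  have hjn : (j : ℝ) ≤ n := by
    exact_mod_cast Nat.lt_succ_iff.1 (Finset.mem_range.1 hj)
  refine ⟨S.filter fun x => dist x a / s < j, Finset.filter_subset _ _, ?_, ?_, ?_⟩
  · simpa [ha] using hj0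
  · intro u hu
    have := (Finset.mem_filter.1 hu).2
    rw [div_lt_iff₀ hs] at this
    exact this.trans_le (mul_le_mul_of_nonneg_right hjn hs.le)
  · intro x hx hxU u hu
    have hu' := (Finset.mem_filter.1 hu).2
    rw [div_lt_iff₀ hs] at hu'
    have h1 : (j : ℝ) ≤ dist x a / s := by
      by_contra! hlt
      exact hxU (Finset.mem_filter.2 ⟨hx, hlt⟩)
    have h2 : j ≤ ⌊dist x a / s⌋₊ := Nat.le_floor h1
    have h3 : j ≠ ⌊dist x a / s⌋₊ := fun h => hj' (Finset.mem_image.2 ⟨x, hx, h.symm⟩)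
    have h4 : ((j + 1 : ℕ) : ℝ) ≤ dist x a / s :=
      (Nat.cast_le.2 (by omega)).trans (Nat.floor_le (by positivity))
    rw [le_div_iff₀ hs] at h4
    push_cast at h4
    have h5 := dist_triangle x u a
    linarith

/-- If every well separated group of points has small net weight, there is a transport plan of small
cost. -/
theorem exists_plan_cost_le (n r : ℕ) (hr : 1 ≤ r) (R : ℝ) : ∃ C : ℝ, 0 ≤ C ∧
    ∀ {α : Type} [MetricSpace α] [DecidableEq α] (A B : Finset α), (A ∪ B).card ≤ n →
    (∀ a ∈ A, ∀ b ∈ B, dist a b ≤ R) → ∀ g h : α → ℝ, (∀ a, 0 ≤ g a) → (∀ b, 0 ≤ h b) →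
    ∑ a ∈ A, g a = ∑ b ∈ B, h b → ∀ M : ℝ, 0 ≤ M →
    (∀ s : ℝ, 0 < s → s ≤ 1 → ∀ U ⊆ A ∪ B, (∀ x ∈ A ∪ B, x ∉ U → ∀ u ∈ U, s ≤ dist x u) →
      s ^ r * |∑ a ∈ A with a ∈ U, g a - ∑ b ∈ B with b ∈ U, h b| ≤ M) →
    ∃ w : α → α → ℝ, (∀ a b, 0 ≤ w a b) ∧ (∀ a ∈ A, ∑ b ∈ B, w a b = g a) ∧
      (∀ b ∈ B, ∑ a ∈ A, w a b = h b) ∧ ∑ a ∈ A, ∑ b ∈ B, w a b * dist a b ^ r ≤ C * M := by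
  -- With `s = d / K`, the part `2 * n` makes groups of radius `n * s` have diameter less than `d`,
  -- and `|R| + 1` ensures `s ≤ 1`.
  set K : ℝ := 2 * n + |R| + 1 with hK
  have hK0 : 0 < K := by positivity
  -- `D N * M` will bound the cost of a pair that has fewer than `N` strictly closer pairs; the
  -- recursion is the one produced by `key`.
  obtain ⟨D, hDs, hD0⟩ : ∃ D : ℕ → ℝ, (∀ N, D (N + 1) = K ^ r * (1 + (n * n : ℕ) * D N)) ∧
      ∀ N, 0 ≤ D N := by
    refine ⟨fun N => N.rec 0 fun _ x => K ^ r * (1 + (n * n : ℕ) * x), fun N => rfl, fun N => ?_⟩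
    induction N with
    | zero => exact le_rfl
    | succ N ih =>
      exact mul_nonneg (by positivity) (add_nonneg zero_le_one (mul_nonneg (by positivity) ih))
  refine ⟨(n * n : ℕ) * D (n * n + 1), mul_nonneg (Nat.cast_nonneg _) (hD0 (n * n + 1)), ?_⟩
  intro α _ _ A B hcard hR g h hg hh hsum M hM hsep
  obtain ⟨w, hw0, hwA, hwB, hst⟩ := exists_greedy_plan A B (fun p => dist p.1 p.2) (A ×ˢ B)
    subset_rfl g h hg hh
  -- The greedy plan moves everything: if some `a` is not exhausted, every `b` is, and the two
  -- totals agree.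
  have hfull : ∑ a ∈ A, ∑ b ∈ B, w a b = ∑ a ∈ A, g a := by
    refine le_antisymm (Finset.sum_le_sum hwA) ?_
    by_cases hA : ∀ a ∈ A, g a ≤ ∑ b ∈ B, w a b
    · exact Finset.sum_le_sum hA
    · push Not at hA
      obtain ⟨a, ha, hlt⟩ := hA
      rw [hsum, Finset.sum_comm]
      refine Finset.sum_le_sum fun b hb => ?_
      rcases hst (a, b) (Finset.mem_product.2 ⟨ha, hb⟩) with h1 | h1
      · exact absurd (h1.trans (Finset.sum_le_sum_of_subset_of_nonneg (Finset.filter_subset _ _)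
          fun _ _ _ => hw0 _ _)) (not_le.2 hlt)
      · exact h1.trans (Finset.sum_le_sum_of_subset_of_nonneg (Finset.filter_subset _ _)
          fun _ _ _ => hw0 _ _)
  have hrow : ∀ a ∈ A, ∑ b ∈ B, w a b = g a := (Finset.sum_eq_sum_iff_of_le hwA).1 hfull
  have hcol : ∀ b ∈ B, ∑ a ∈ A, w a b = h b :=
    (Finset.sum_eq_sum_iff_of_le hwB).1 (by rw [Finset.sum_comm, hfull, hsum])
  have hcA : A.card ≤ n := (Finset.card_le_card Finset.subset_union_left).trans hcard
  have hcB : B.card ≤ n := (Finset.card_le_card Finset.subset_union_right).trans hcard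
  have hcAB : (A ×ˢ B).card ≤ n * n := by
    rw [Finset.card_product]
    exact Nat.mul_le_mul hcA hcB
  have key : ∀ N, ∀ a ∈ A, ∀ b ∈ B, ((A ×ˢ B).filter fun p => dist p.1 p.2 < dist a b).card < N →
      w a b * dist a b ^ r ≤ D N * M := by
    intro N
    induction N with
    | zero => intro a _ b _ hlt; omega
    | succ N ih =>
      intro a₀ ha₀ b₀ hb₀ hN
      have hDM : 0 ≤ D (N + 1) * M := mul_nonneg (hD0 _) hM
      rcases (hw0 a₀ b₀).eq_or_lt with hw | hw
      · rw [← hw, zero_mul]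
        exact hDM
      rcases (dist_nonneg (x := a₀) (y := b₀)).eq_or_lt with hd | hd
      · rw [← hd, zero_pow (by omega), mul_zero]
        exact hDM
      set d := dist a₀ b₀ with hdd
      have hs : 0 < d / K := by positivity
      have hs1 : d / K ≤ 1 := by
        rw [div_le_one hK0]
        have := hR a₀ ha₀ b₀ hb₀
        have := le_abs_self R
        have : (0 : ℝ) ≤ n := n.cast_nonneg
        linarith
      set s := d / K with hsd
      have hsK : d = s * K := by rw [hsd]; field_simp
      -- The mass `w a₀ b₀` travels the distance `d` although closer partners come first. The group
      -- around `a₀` must then have a surplus of `g`, up to mass that crosses the gap around `U`.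
      obtain ⟨U, hUS, haU, hUd, hUsep⟩ := exists_separated_group (A ∪ B) hcard
        (Finset.mem_union_left _ ha₀) hs
      have hUlt : ∀ u ∈ U, ∀ v ∈ U, dist u v < d := by
        intro u hu v hv
        have h1 := hUd u hu
        have h2 := hUd v hv
        have h3 := dist_triangle_right u v a₀
        have h4 : 0 ≤ s * |R| := by positivity
        rw [hsK, hK]
        nlinarith
      -- The part of the plan that moves mass by less than `d`.
      let W : α → α → ℝ := fun a b => if dist a b < d then w a b else 0
      have hW0 : ∀ a b, 0 ≤ W a b := fun a b => by
        simp only [W]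
        split_ifs
        exacts [hw0 a b, le_rfl]
      have hWw : ∀ a b, W a b ≤ w a b := fun a b => by
        simp only [W]
        split_ifs
        exacts [le_rfl, hw0 a b]
      have hg_lt : w a₀ b₀ + ∑ b ∈ B, W a₀ b ≤ g a₀ := by
        rw [← hrow a₀ ha₀, ← Finset.add_sum_erase B _ hb₀, ← Finset.add_sum_erase B _ hb₀]
        have h1 : W a₀ b₀ = 0 := if_neg (lt_irrefl _)
        rw [h1, zero_add]
        gcongr with b hb
        exact hWw _ _
      have hg_le : ∀ a ∈ A, ∑ b ∈ B, W a b ≤ g a := fun a ha =>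
        (Finset.sum_le_sum fun b _ => hWw a b).trans (hwA a ha)
      -- Every `b` in `U` is closer to `a₀` than `d`. Pairs closer than `d` do not exhaust `a₀`,
      -- since `w a₀ b₀ > 0` is still to be sent; by the greedy property they exhaust `b`.
      have hh_le : ∀ b ∈ B, b ∈ U → h b ≤ ∑ a ∈ A, W a b := by
        intro b hb hbU
        rcases hst (a₀, b) (Finset.mem_product.2 ⟨ha₀, hb⟩) with h1 | h1
        · exfalso
          have h2 : ∑ b' ∈ B with dist a₀ b' ≤ dist a₀ b, w a₀ b' ≤ ∑ b ∈ B, W a₀ b := by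
            rw [Finset.sum_filter]
            refine Finset.sum_le_sum fun b' _ => ?_
            split_ifs with h3
            · simp only [W]
              rw [if_pos (h3.trans_lt (hUlt _ haU _ hbU))]
            · exact hW0 _ _
          simp only at h1
          linarith
        · refine h1.trans ?_
          rw [Finset.sum_filter]
          refine Finset.sum_le_sum fun a' _ => ?_
          split_ifs with h3
          · simp only [W]
            rw [if_pos (h3.trans_lt (hUlt _ haU _ hbU))]
          · exact hW0 _ _
      have hA : w a₀ b₀ + ∑ a ∈ A with a ∈ U, ∑ b ∈ B, W a b ≤ ∑ a ∈ A with a ∈ U, g a := by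
        have hmem : a₀ ∈ A.filter (· ∈ U) := Finset.mem_filter.2 ⟨ha₀, haU⟩
        rw [← Finset.add_sum_erase _ _ hmem, ← Finset.add_sum_erase _ _ hmem, ← add_assoc]
        refine add_le_add hg_lt (Finset.sum_le_sum fun a ha => hg_le a ?_)
        exact (Finset.mem_filter.1 (Finset.mem_of_mem_erase ha)).1
      have hB : ∑ b ∈ B with b ∈ U, h b ≤ ∑ b ∈ B with b ∈ U, ∑ a ∈ A, W a b :=
        Finset.sum_le_sum fun b hb => hh_le b (Finset.mem_filter.1 hb).1 (Finset.mem_filter.1 hb).2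
      have hsplit : ∑ b ∈ B with b ∈ U, ∑ a ∈ A, W a b ≤ ∑ a ∈ A with a ∈ U, ∑ b ∈ B, W a b +
          ∑ b ∈ B with b ∈ U, ∑ a ∈ A with a ∉ U, W a b := by
        simp only [← Finset.sum_filter_add_sum_filter_not A (· ∈ U), Finset.sum_add_distrib]
        refine add_le_add ?_ le_rfl
        rw [Finset.sum_comm]
        exact Finset.sum_le_sum fun a _ => Finset.sum_le_sum_of_subset_of_nonneg
          (Finset.filter_subset _ _) fun _ _ _ => hW0 _ _
      -- Pairs crossing the gap have distance at least `s`, so `s ^ r` times their mass is at most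
      -- their cost. Those in `W` are closer than `d`, so the induction hypothesis bounds that cost.
      have hcross : s ^ r * ∑ b ∈ B with b ∈ U, ∑ a ∈ A with a ∉ U, W a b ≤
          (n * n : ℕ) * (D N * M) := by
        have hDN : 0 ≤ D N * M := mul_nonneg (hD0 _) hM
        have hone : ∀ b ∈ B.filter (· ∈ U), ∀ a ∈ A.filter (· ∉ U), s ^ r * W a b ≤ D N * M := by
          intro b hb a ha
          obtain ⟨hb, hbU⟩ := Finset.mem_filter.1 hb
          obtain ⟨ha, haU⟩ := Finset.mem_filter.1 ha
          by_cases hlt : dist a b < d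
          · simp only [W]
            rw [if_pos hlt]
            refine le_trans ?_ (ih a ha b hb ?_)
            · rw [mul_comm]
              exact mul_le_mul_of_nonneg_left (pow_le_pow_left₀ hs.le
                (hUsep a (Finset.mem_union_left _ ha) haU b hbU) r) (hw0 a b)
            · refine lt_of_lt_of_le (Finset.card_lt_card ?_) (Nat.lt_succ_iff.1 hN)
              refine Finset.ssubset_iff_of_subset (fun p hp => ?_) |>.2 ⟨(a, b), ?_, ?_⟩
              · rw [Finset.mem_filter] at hp ⊢
                exact ⟨hp.1, hp.2.trans hlt⟩
              · exact Finset.mem_filter.2 ⟨Finset.mem_product.2 ⟨ha, hb⟩, hlt⟩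
              · simp
          · simp only [W]
            rw [if_neg hlt, mul_zero]
            exact hDN
        rw [Finset.mul_sum]
        simp only [Finset.mul_sum]
        refine (Finset.sum_le_sum fun b hb => Finset.sum_le_sum (hone b hb)).trans ?_
        simp only [Finset.sum_const, nsmul_eq_mul]
        rw [← mul_assoc, ← Nat.cast_mul]
        refine mul_le_mul_of_nonneg_right (Nat.cast_le.2 (Nat.mul_le_mul ?_ ?_)) hDN
        · exact (Finset.card_filter_le _ _).trans hcB
        · exact (Finset.card_filter_le _ _).trans hcA
      have hν := hsep s hs hs1 U hUS hUsep
      have hsr : 0 ≤ s ^ r := by positivity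
      have hfin : s ^ r * w a₀ b₀ ≤ (1 + (n * n : ℕ) * D N) * M := by
        have h1 : w a₀ b₀ ≤ |∑ a ∈ A with a ∈ U, g a - ∑ b ∈ B with b ∈ U, h b| +
            ∑ b ∈ B with b ∈ U, ∑ a ∈ A with a ∉ U, W a b := by
          have := le_abs_self (∑ a ∈ A with a ∈ U, g a - ∑ b ∈ B with b ∈ U, h b)
          linarith
        have h2 := mul_le_mul_of_nonneg_left h1 hsr
        rw [mul_add] at h2
        linarith
      have hKr : (0 : ℝ) ≤ K ^ r := by positivity
      calc w a₀ b₀ * d ^ r = K ^ r * (s ^ r * w a₀ b₀) := by rw [hsK, mul_pow]; ring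
        _ ≤ K ^ r * ((1 + (n * n : ℕ) * D N) * M) := mul_le_mul_of_nonneg_left hfin hKr
        _ = D (N + 1) * M := by rw [hDs, mul_assoc]
  refine ⟨w, hw0, hrow, hcol, ?_⟩
  have hle : ∀ a ∈ A, ∀ b ∈ B, w a b * dist a b ^ r ≤ D (n * n + 1) * M := fun a ha b hb =>
    key _ a ha b hb (Nat.lt_succ_of_le ((Finset.card_filter_le _ _).trans hcAB))
  refine (Finset.sum_le_sum fun a ha => Finset.sum_le_sum (hle a ha)).trans ?_
  simp only [Finset.sum_const, nsmul_eq_mul]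
  rw [← mul_assoc, ← Nat.cast_mul, ← Finset.card_product, mul_assoc]
  exact mul_le_mul_of_nonneg_right (Nat.cast_le.2 hcAB) (mul_nonneg (hD0 _) hM)


/-! ### Wasserstein distance of mixing measures -/

section MixingMeasures

variable {q : ℕ}

theorem MixingMeasure.sum_weights (G : MixingMeasure q) : ∑ θ ∈ G.weights.support, G.weights θ = 1 :=
  G.total

/-- The atoms of `G`, padded to a family of exactly `k` points. -/
theorem MixingMeasure.exists_enum (G : MixingMeasure q) {k : ℕ} (hG : G.weights.support.card ≤ k) :
    ∃ (z : Fin k → EuclideanSpace ℝ (Fin q)) (w : Fin k → ℝ),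
      (∀ i, z i ∈ G.weights.support) ∧ (∀ θ ∈ G.weights.support, ∃ i, z i = θ) ∧
      ∀ F : EuclideanSpace ℝ (Fin q) → ℝ,
        ∑ i, w i * F (z i) = ∑ θ ∈ G.weights.support, G.weights θ * F θ := by
  classical
  obtain ⟨θ₀, hθ₀⟩ := G.support_weights_nonempty
  have : Nonempty G.weights.support := ⟨⟨θ₀, hθ₀⟩⟩
  obtain ⟨e⟩ : Nonempty (G.weights.support ↪ Fin k) :=
    Function.Embedding.nonempty_of_card_le (by simpa using hG)
  have hinv : Function.LeftInverse (Function.invFun e) e := Function.leftInverse_invFun e.injective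
  -- Outside the range of `e`, `invFun` returns some atom; giving it weight 0 keeps all points in
  -- the support without changing the sums.
  refine ⟨fun i => (Function.invFun e i : G.weights.support), fun i =>
    if i ∈ Set.range e then G.weights (Function.invFun e i : G.weights.support) else 0,
    fun i => (Function.invFun e i).2, fun θ hθ => ⟨e ⟨θ, hθ⟩, congrArg Subtype.val (hinv ⟨θ, hθ⟩)⟩, fun F => ?_⟩
  rw [← Finset.sum_coe_sort G.weights.support]
  have h := Finset.sum_map Finset.univ e fun i : Fin k =>
    (if i ∈ Set.range e then G.weights (Function.invFun e i : G.weights.support) else 0) *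
      F (Function.invFun e i : G.weights.support)
  have h1 : ∀ x : G.weights.support, (if e x ∈ Set.range e then
      G.weights (Function.invFun e (e x) : G.weights.support) else 0) *
      F (Function.invFun e (e x) : G.weights.support) = G.weights x * F x := by
    intro x
    rw [if_pos (Set.mem_range_self x), hinv]
  rw [Finset.sum_congr rfl fun x _ => h1 x] at h
  rw [← h]
  symm
  refine Finset.sum_subset (Finset.subset_univ _) fun i _ hi => ?_
  rw [if_neg, zero_mul]
  rintro ⟨x, rfl⟩
  exact hi (Finset.mem_map_of_mem _ (Finset.mem_univ x))

theorem isCoupling_mul (G H : MixingMeasure q) :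
    IsCoupling G H fun θ η => G.weights θ * H.weights η where
  nonneg _ _ _ _ := mul_nonneg (G.weights_nonneg _) (H.weights_nonneg _)
  fst θ _ := by rw [← Finset.mul_sum, H.sum_weights, mul_one]
  snd η _ := by rw [← Finset.sum_mul, G.sum_weights, one_mul]

theorem transportCost_nonneg {G H : MixingMeasure q}
    {w : EuclideanSpace ℝ (Fin q) → EuclideanSpace ℝ (Fin q) → ℝ} (hw : IsCoupling G H w) (l : ℕ) :
    0 ≤ transportCost l G H w :=
  Finset.sum_nonneg fun θ hθ => Finset.sum_nonneg fun η hη =>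
    mul_nonneg (hw.nonneg θ hθ η hη) (by positivity)

theorem wasserstein_pow {r : ℕ} (hr : r ≠ 0) (G H : MixingMeasure q) :
    wasserstein r G H ^ r = sInf {c : ℝ | ∃ w, IsCoupling G H w ∧ c = transportCost r G H w} := by
  rw [wasserstein, one_div, Real.rpow_inv_natCast_pow _ hr]
  refine Real.sInf_nonneg ?_
  rintro c ⟨w, hw, rfl⟩
  exact transportCost_nonneg hw r

theorem le_wasserstein_pow {r : ℕ} (hr : r ≠ 0) {G H : MixingMeasure q} {a : ℝ}
    (h : ∀ w, IsCoupling G H w → a ≤ transportCost r G H w) : a ≤ wasserstein r G H ^ r := by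
  rw [wasserstein_pow hr]
  refine le_csInf ⟨_, _, isCoupling_mul G H, rfl⟩ ?_
  rintro c ⟨w, hw, rfl⟩
  exact h w hw

theorem wasserstein_pow_le {r : ℕ} (hr : r ≠ 0) {G H : MixingMeasure q}
    {w : EuclideanSpace ℝ (Fin q) → EuclideanSpace ℝ (Fin q) → ℝ} (hw : IsCoupling G H w) :
    wasserstein r G H ^ r ≤ transportCost r G H w := by
  rw [wasserstein_pow hr]
  refine csInf_le ⟨0, ?_⟩ ⟨w, hw, rfl⟩
  rintro c ⟨w, hw, rfl⟩
  exact transportCost_nonneg hw r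

/-- If all atoms of `H` other than `θ` are far from `θ`, the excess of `G` at `θ` is expensive. -/
theorem le_wasserstein_pow_of_dist {r : ℕ} (hr : r ≠ 0) {G H : MixingMeasure q}
    {θ : EuclideanSpace ℝ (Fin q)} (hθ : θ ∈ G.weights.support) {δ : ℝ} (hδ : 0 ≤ δ)
    (hH : ∀ η ∈ H.weights.support, η ≠ θ → δ ≤ dist θ η) :
    (G.weights θ - H.weights θ) * δ ^ r ≤ wasserstein r G H ^ r := by
  classical
  refine le_wasserstein_pow hr fun w hw => ?_
  have h1 : ∑ η ∈ H.weights.support, w θ η * ‖θ - η‖ ^ r ≤ transportCost r G H w :=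
    Finset.single_le_sum (f := fun θ => ∑ η ∈ H.weights.support, w θ η * ‖θ - η‖ ^ r)
      (fun θ hθ => Finset.sum_nonneg fun η hη =>
        mul_nonneg (hw.nonneg θ hθ η hη) (by positivity)) hθ
  refine le_trans ?_ h1
  have h2 : ∑ η ∈ H.weights.support.erase θ, w θ η * δ ^ r ≤
      ∑ η ∈ H.weights.support, w θ η * ‖θ - η‖ ^ r := by
    refine (Finset.sum_le_sum fun η hη => ?_).trans (Finset.sum_le_sum_of_subset_of_nonneg
      (Finset.erase_subset θ _) fun η hη _ => mul_nonneg (hw.nonneg θ hθ η hη) (by positivity))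
    obtain ⟨hne, hη⟩ := Finset.mem_erase.1 hη
    rw [← dist_eq_norm]
    exact mul_le_mul_of_nonneg_left (pow_le_pow_left₀ hδ (hH η hη hne) r) (hw.nonneg θ hθ η hη)
  refine le_trans ?_ h2
  rw [← Finset.sum_mul]
  refine mul_le_mul_of_nonneg_right ?_ (by positivity)
  rw [← hw.fst θ hθ]
  by_cases hθH : θ ∈ H.weights.support
  · rw [← Finset.add_sum_erase _ _ hθH]
    have h3 : w θ θ ≤ H.weights θ := by
      rw [← hw.snd θ hθH]
      exact Finset.single_le_sum (f := fun θ' => w θ' θ) (fun θ' hθ' => hw.nonneg θ' hθ' θ hθH) hθ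
    linarith
  · rw [Finset.erase_eq_of_notMem hθH]
    linarith [H.weights_nonneg θ]

theorem exists_lt_weights_of_ne {G H : MixingMeasure q} (h : G ≠ H) :
    ∃ θ ∈ G.weights.support, H.weights θ < G.weights θ := by
  classical
  by_contra! hcon
  refine h ?_
  have h1 : ∀ θ ∈ G.weights.support ∪ H.weights.support, G.weights θ ≤ H.weights θ := by
    intro θ _
    by_cases hθ : θ ∈ G.weights.support
    · exact hcon θ hθ
    · rw [Finsupp.notMem_support_iff.1 hθ]
      exact H.weights_nonneg θ
  have h2 := (Finset.sum_eq_sum_iff_of_le h1).1 (by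
    rw [← Finset.sum_subset Finset.subset_union_left fun θ _ hθ => Finsupp.notMem_support_iff.1 hθ,
      ← Finset.sum_subset Finset.subset_union_right fun θ _ hθ => Finsupp.notMem_support_iff.1 hθ,
      G.sum_weights, H.sum_weights])
  ext θ
  by_cases hθ : θ ∈ G.weights.support ∪ H.weights.support
  · exact h2 θ hθ
  · rw [Finset.mem_union, not_or, Finsupp.notMem_support_iff, Finsupp.notMem_support_iff] at hθ
    rw [hθ.1, hθ.2]

/-- Some atom has more weight in `G` than in `H`, and the excess has to travel a positive distance.
Positivity keeps the quotient in the theorem away from division by zero. -/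
theorem wasserstein_pow_pos {r : ℕ} (hr : r ≠ 0) {G H : MixingMeasure q} (h : G ≠ H) :
    0 < wasserstein r G H ^ r := by
  classical
  obtain ⟨θ, hθ, hlt⟩ := exists_lt_weights_of_ne h
  obtain ⟨δ, hδ, hδ'⟩ : ∃ δ > 0, ∀ η ∈ H.weights.support, η ≠ θ → δ ≤ dist θ η := by
    rcases (H.weights.support.erase θ).eq_empty_or_nonempty with he | hne
    · exact ⟨1, one_pos, fun η hη hηθ =>
        absurd (Finset.mem_erase.2 ⟨hηθ, hη⟩) (by rw [he]; exact Finset.notMem_empty _)⟩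
    · obtain ⟨η₀, hη₀, hmin⟩ := Finset.exists_min_image _ (fun η => dist θ η) hne
      exact ⟨dist θ η₀, dist_pos.2 (Finset.ne_of_mem_erase hη₀).symm,
        fun η hη hηθ => hmin η (Finset.mem_erase.2 ⟨hηθ, hη⟩)⟩
  exact (mul_pos (sub_pos.2 hlt) (pow_pos hδ r)).trans_le
    (le_wasserstein_pow_of_dist hr hθ hδ.le hδ')

theorem wasserstein_one_comm (G H : MixingMeasure q) : wasserstein 1 G H = wasserstein 1 H G := by
  have key : ∀ G H : MixingMeasure q, wasserstein 1 G H ≤ wasserstein 1 H G := by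
    intro G H
    rw [← pow_one (wasserstein 1 G H), ← pow_one (wasserstein 1 H G)]
    refine le_wasserstein_pow one_ne_zero fun w hw => ?_
    refine (wasserstein_pow_le one_ne_zero (w := fun θ η => w η θ)
      ⟨fun θ hθ η hη => hw.nonneg η hη θ hθ, hw.snd, hw.fst⟩).trans (le_of_eq ?_)
    rw [transportCost, transportCost, Finset.sum_comm]
    simp only [norm_sub_rev]
  exact le_antisymm (key G H) (key H G)

/-- If `W₁(G, G₀)` is small, `G` has an atom near every atom of `G₀`. -/
theorem exists_atom_near {G G₀ : MixingMeasure q} {θ : EuclideanSpace ℝ (Fin q)}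
    (hθ : θ ∈ G₀.weights.support) {δ : ℝ} (hδ : 0 < δ)
    (h : wasserstein 1 G G₀ < G₀.weights θ * δ) : ∃ η ∈ G.weights.support, dist η θ < δ := by
  by_contra! hcon
  have hθG : G.weights θ = 0 := by
    rw [← Finsupp.notMem_support_iff]
    intro hθG
    exact absurd (hcon θ hθG) (by simpa using hδ)
  have := le_wasserstein_pow_of_dist one_ne_zero (G := G₀) (H := G) hθ hδ.le
    fun η hη _ => by rw [dist_comm]; exact hcon η hη
  rw [hθG, sub_zero, pow_one, pow_one, wasserstein_one_comm] at this
  linarith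

/-- The Wasserstein distance is controlled by the net weights of well separated groups of atoms. -/
theorem exists_wasserstein_pow_le (q n r : ℕ) (hr : 1 ≤ r) (R : ℝ) : ∃ C : ℝ, 0 ≤ C ∧
    ∀ G H : MixingMeasure q, (G.weights.support ∪ H.weights.support).card ≤ n →
    (∀ θ ∈ G.weights.support, ∀ η ∈ H.weights.support, dist θ η ≤ R) → ∀ M : ℝ, 0 ≤ M →
    (∀ s : ℝ, 0 < s → s ≤ 1 → ∀ U ⊆ G.weights.support ∪ H.weights.support,
      (∀ x ∈ G.weights.support ∪ H.weights.support, x ∉ U → ∀ u ∈ U, s ≤ dist x u) →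
      s ^ r * |∑ θ ∈ G.weights.support,
          G.weights θ * Set.indicator (U : Set (EuclideanSpace ℝ (Fin q))) 1 θ -
        ∑ η ∈ H.weights.support,
          H.weights η * Set.indicator (U : Set (EuclideanSpace ℝ (Fin q))) 1 η| ≤ M) →
    wasserstein r G H ^ r ≤ C * M := by
  classical
  obtain ⟨C, hC, hCb⟩ := exists_plan_cost_le n r hr R
  refine ⟨C, hC, fun G H hn hR M hM hsep => ?_⟩
  obtain ⟨w, hw0, hw1, hw2, hcost⟩ := hCb G.weights.support H.weights.support (by convert hn) hR
    G.weights H.weights G.weights_nonneg H.weights_nonneg (by rw [G.sum_weights, H.sum_weights])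
    M hM (fun s hs hs1 U hU hUs => by
      have hind : ∀ (S : Finset (EuclideanSpace ℝ (Fin q))) (g : EuclideanSpace ℝ (Fin q) → ℝ),
          ∑ a ∈ S with a ∈ U, g a =
            ∑ a ∈ S, g a * Set.indicator (U : Set (EuclideanSpace ℝ (Fin q))) 1 a := by
        intro S g
        rw [Finset.sum_filter]
        refine Finset.sum_congr rfl fun a _ => ?_
        simp [Set.indicator_apply]
      rw [hind, hind]
      refine hsep s hs hs1 U (by convert hU) fun x hx => hUs x (by convert hx))
  refine (wasserstein_pow_le (by omega) (w := w) ⟨fun θ _ η _ => hw0 θ η, hw1, hw2⟩).trans ?_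
  simpa only [transportCost, dist_eq_norm] using hcost

end MixingMeasures

/-! ### Moments around several limit points -/

/-- The total size of the moments of the weights `w` at the points `z`, taken separately around each
of the points `c i`. The order of the moments is bounded by the number of points in the group. -/
def clusterMoments {q : ℕ} {κ : Type} [Fintype κ]
    (c z : κ → EuclideanSpace ℝ (Fin q)) (w : κ → ℝ) : ℝ :=
  open scoped Classical in
  ∑ v ∈ Finset.univ.image c, ∑ α ∈ multiIndices q ({i | c i = v} : Finset κ).card,
    |∑ i with c i = v, w i * shiftedMonomial v α (z i)|

theorem clusterMoments_nonneg {q : ℕ} {κ : Type} [Fintype κ]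
    (c z : κ → EuclideanSpace ℝ (Fin q)) (w : κ → ℝ) : 0 ≤ clusterMoments c z w :=
  Finset.sum_nonneg fun _ _ => Finset.sum_nonneg fun _ _ => abs_nonneg _

-- The inequality for one limit point is applied to each cluster. A cluster of `m + 1` points yields
-- the factor `s ^ m`, which is at least `s ^ r` because `m ≤ r` and `s ≤ 1`.
open scoped Classical in
theorem exists_pow_mul_abs_sum_le_clusterMoments {q : ℕ} {κ : Type} [Fintype κ]
    (c : κ → EuclideanSpace ℝ (Fin q)) (n r : ℕ)
    (hr : ∀ v, ({i | c i = v} : Finset κ).card ≤ r + 1) : ∃ C : ℝ, 0 ≤ C ∧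
    ∀ z : κ → EuclideanSpace ℝ (Fin q), (∀ i j, |z i j - c i j| ≤ 1) →
    ∀ (s : ℝ), 0 < s → s ≤ 1 → ∀ (U : Finset (EuclideanSpace ℝ (Fin q))), U.card ≤ n →
    (∀ i, z i ∉ U → ∀ u ∈ U, s ≤ dist (z i) u) → ∀ w : κ → ℝ,
      s ^ r * |∑ i, w i * Set.indicator (U : Set (EuclideanSpace ℝ (Fin q))) 1 (z i)| ≤
        C * clusterMoments c z w := by
  choose C hC hCb using fun m => exists_pow_mul_abs_sum_le_moments q m n
  refine ⟨∑ m ∈ Finset.range (r + 1), C m, Finset.sum_nonneg fun m _ => hC m,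
    fun z hz s hs hs1 U hU hsep w => ?_⟩
  rw [← Finset.sum_fiberwise_of_maps_to (s := Finset.univ) (t := Finset.univ.image c) (g := c)
    (fun i _ => Finset.mem_image_of_mem c (Finset.mem_univ i)), clusterMoments, Finset.mul_sum]
  refine (mul_le_mul_of_nonneg_left (Finset.abs_sum_le_sum_abs _ _) (by positivity)).trans ?_
  rw [Finset.mul_sum]
  refine Finset.sum_le_sum fun v hv => ?_
  obtain ⟨i₀, -, hi₀⟩ := Finset.mem_image.1 hv
  have hpos : 0 < ({i | c i = v} : Finset κ).card :=
    Finset.card_pos.2 ⟨i₀, by simpa using hi₀⟩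
  obtain ⟨m, hm⟩ : ∃ m, ({i | c i = v} : Finset κ).card = m + 1 := ⟨_, (Nat.succ_pred_eq_of_pos hpos).symm⟩
  have hmr : m ≤ r := by
    have := hr v
    omega
  have h := hCb m v ({i | c i = v} : Finset κ) hm.le z (fun i hi j => by
    rw [← (Finset.mem_filter.1 hi).2]
    exact hz i j) s hs hs1 U hU (fun i _ => hsep i) w
  rw [hm]
  refine (mul_le_mul_of_nonneg_right (pow_le_pow_of_le_one hs.le hs1 hmr) (abs_nonneg _)).trans
    (h.trans (mul_le_mul_of_nonneg_right ?_ (Finset.sum_nonneg fun _ _ => abs_nonneg _)))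
  exact Finset.single_le_sum (f := C) (fun m _ => hC m) (Finset.mem_range.2 (by omega))


/-! ### Total variation and the L¹ distance of densities -/

section TotalVariation

variable {q : ℕ} {X : Type*} [MeasurableSpace X] {lam : Measure X}
  {Θ : Set (EuclideanSpace ℝ (Fin q))} {P : EuclideanSpace ℝ (Fin q) → Measure X}
  {p : X → EuclideanSpace ℝ (Fin q) → ℝ}

theorem abs_measureReal_sub_le_totalVariationDist (μ ν : Measure X) [IsFiniteMeasure μ]
    [IsFiniteMeasure ν] {A : Set X} (hA : MeasurableSet A) :
    |μ.real A - ν.real A| ≤ totalVariationDist μ ν := by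
  refine le_ciSup (f := fun A : {A : Set X // MeasurableSet A} => |μ.real A - ν.real A|)
    ⟨μ.real Set.univ + ν.real Set.univ, ?_⟩ ⟨A, hA⟩
  rintro _ ⟨B, rfl⟩
  refine (abs_sub _ _).trans ?_
  rw [abs_of_nonneg measureReal_nonneg, abs_of_nonneg measureReal_nonneg]
  exact add_le_add (measureReal_mono (Set.subset_univ _)) (measureReal_mono (Set.subset_univ _))

theorem integrable_density (hP : ∀ θ ∈ Θ, IsProbabilityMeasure (P θ))
    (hp_meas : ∀ θ ∈ Θ, Measurable fun x => p x θ) (hp_nonneg : ∀ θ ∈ Θ, ∀ x, 0 ≤ p x θ)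
    (hp_density : ∀ θ ∈ Θ, P θ = lam.withDensity fun x => ENNReal.ofReal (p x θ))
    {θ : EuclideanSpace ℝ (Fin q)} (hθ : θ ∈ Θ) : Integrable (fun x => p x θ) lam := by
  refine ⟨(hp_meas θ hθ).aestronglyMeasurable, ?_⟩
  rw [hasFiniteIntegral_iff_ofReal (ae_of_all _ (hp_nonneg θ hθ))]
  have h := (hP θ hθ).measure_univ
  rw [hp_density θ hθ, withDensity_apply _ MeasurableSet.univ, Measure.restrict_univ] at h
  rw [h]
  exact ENNReal.one_lt_top

theorem measureReal_eq_setIntegral_density (hp_meas : ∀ θ ∈ Θ, Measurable fun x => p x θ)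
    (hp_nonneg : ∀ θ ∈ Θ, ∀ x, 0 ≤ p x θ)
    (hp_density : ∀ θ ∈ Θ, P θ = lam.withDensity fun x => ENNReal.ofReal (p x θ))
    {θ : EuclideanSpace ℝ (Fin q)} (hθ : θ ∈ Θ) {A : Set X} (hA : MeasurableSet A) :
    (P θ).real A = ∫ x in A, p x θ ∂lam := by
  rw [integral_eq_lintegral_of_nonneg_ae (ae_of_all _ (hp_nonneg θ hθ))
    (hp_meas θ hθ).aestronglyMeasurable, measureReal_def, hp_density θ hθ, withDensity_apply _ hA]

theorem isFiniteMeasure_mixture (hP : ∀ θ ∈ Θ, IsProbabilityMeasure (P θ)) {G : MixingMeasure q}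
    (hG : ∀ θ ∈ G.weights.support, θ ∈ Θ) : IsFiniteMeasure (mixture P G) := by
  refine ⟨?_⟩
  rw [mixture, Measure.finsetSum_apply]
  refine ENNReal.sum_lt_top.2 fun θ hθ => ?_
  have := hP θ (hG θ hθ)
  rw [Measure.smul_apply, smul_eq_mul]
  exact ENNReal.mul_lt_top ENNReal.ofReal_lt_top (measure_lt_top _ _)

theorem mixture_measureReal (hP : ∀ θ ∈ Θ, IsProbabilityMeasure (P θ))
    (hp_meas : ∀ θ ∈ Θ, Measurable fun x => p x θ)
    (hp_nonneg : ∀ θ ∈ Θ, ∀ x, 0 ≤ p x θ)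
    (hp_density : ∀ θ ∈ Θ, P θ = lam.withDensity fun x => ENNReal.ofReal (p x θ))
    {G : MixingMeasure q} (hG : ∀ θ ∈ G.weights.support, θ ∈ Θ) {A : Set X} (hA : MeasurableSet A) :
    (mixture P G).real A = ∫ x in A, ∑ θ ∈ G.weights.support, G.weights θ * p x θ ∂lam := by
  rw [integral_finsetSum _ fun θ hθ => ((integrable_density hP hp_meas hp_nonneg hp_density
    (hG θ hθ)).const_mul _).integrableOn, measureReal_def, mixture, Measure.finsetSum_apply,
    ENNReal.toReal_sum]
  · refine Finset.sum_congr rfl fun θ hθ => ?_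
    rw [integral_const_mul, ← measureReal_eq_setIntegral_density hp_meas hp_nonneg hp_density
      (hG θ hθ) hA, Measure.smul_apply, smul_eq_mul, ENNReal.toReal_mul,
      ENNReal.toReal_ofReal (G.weights_nonneg θ), measureReal_def]
  · intro θ hθ
    have := hP θ (hG θ hθ)
    rw [Measure.smul_apply, smul_eq_mul]
    exact (ENNReal.mul_lt_top ENNReal.ofReal_lt_top (measure_lt_top _ _)).ne

/-- The integral is split at the set where the difference of the densities is nonnegative; on this
set and on its complement it is a difference of probabilities up to sign. -/
theorem lintegral_enorm_mixture_sub_le (hP : ∀ θ ∈ Θ, IsProbabilityMeasure (P θ))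
    (hp_meas : ∀ θ ∈ Θ, Measurable fun x => p x θ)
    (hp_nonneg : ∀ θ ∈ Θ, ∀ x, 0 ≤ p x θ)
    (hp_density : ∀ θ ∈ Θ, P θ = lam.withDensity fun x => ENNReal.ofReal (p x θ))
    {G H : MixingMeasure q} (hG : ∀ θ ∈ G.weights.support, θ ∈ Θ)
    (hH : ∀ θ ∈ H.weights.support, θ ∈ Θ) :
    ∫⁻ x, ‖∑ θ ∈ G.weights.support, G.weights θ * p x θ -
      ∑ θ ∈ H.weights.support, H.weights θ * p x θ‖ₑ ∂lam ≤
      ENNReal.ofReal (2 * totalVariationDist (mixture P G) (mixture P H)) := by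
  have hint : ∀ {G : MixingMeasure q}, (∀ θ ∈ G.weights.support, θ ∈ Θ) →
      Integrable (fun x => ∑ θ ∈ G.weights.support, G.weights θ * p x θ) lam := fun hG =>
    integrable_finsetSum _ fun θ hθ =>
      (integrable_density hP hp_meas hp_nonneg hp_density (hG θ hθ)).const_mul _
  have hmeas : ∀ {G : MixingMeasure q}, (∀ θ ∈ G.weights.support, θ ∈ Θ) →
      Measurable (fun x => ∑ θ ∈ G.weights.support, G.weights θ * p x θ) := fun hG =>
    Finset.measurable_fun_sum _ fun θ hθ => (hp_meas θ (hG θ hθ)).const_mul _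
  have := isFiniteMeasure_mixture hP hG
  have := isFiniteMeasure_mixture hP hH
  set d : X → ℝ := fun x => ∑ θ ∈ G.weights.support, G.weights θ * p x θ -
      ∑ θ ∈ H.weights.support, H.weights θ * p x θ with hd
  have hdi : Integrable d lam := (hint hG).sub (hint hH)
  have hdm : Measurable d := (hmeas hG).sub (hmeas hH)
  have hA : MeasurableSet {x | 0 ≤ d x} := measurableSet_le measurable_const hdm
  have hle : ∀ A : Set X, MeasurableSet A →
      |∫ x in A, d x ∂lam| ≤ totalVariationDist (mixture P G) (mixture P H) := by
    intro A hA
    refine le_of_eq_of_le ?_ (abs_measureReal_sub_le_totalVariationDist _ _ hA)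
    rw [mixture_measureReal hP hp_meas hp_nonneg hp_density hG hA,
      mixture_measureReal hP hp_meas hp_nonneg hp_density hH hA,
      ← integral_sub (hint hG).integrableOn (hint hH).integrableOn]
  rw [← ofReal_integral_norm_eq_lintegral_enorm hdi]
  refine ENNReal.ofReal_le_ofReal ?_
  rw [← integral_add_compl hA hdi.norm, two_mul]
  refine add_le_add ?_ ?_
  · refine le_trans (le_of_eq ?_) ((le_abs_self _).trans (hle _ hA))
    exact setIntegral_congr_fun hA fun x hx => Real.norm_of_nonneg hx
  · refine le_trans (le_of_eq ?_) ((neg_le_abs _).trans (hle _ hA.compl))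
    rw [← integral_neg]
    refine setIntegral_congr_fun hA.compl fun x hx => Real.norm_of_nonpos (le_of_lt ?_)
    simpa using hx

end TotalVariation

/-! ### Limits of normalised combinations and linear independence -/

theorem exists_subseq_tendsto_of_abs_le_one {β : Type*} (S : Finset β) (a : ℕ → β → ℝ)
    (ha : ∀ n, ∀ b ∈ S, |a n b| ≤ 1) : ∃ (l : β → ℝ) (φ : ℕ → ℕ), StrictMono φ ∧
      ∀ b ∈ S, Tendsto (fun n => a (φ n) b) atTop (𝓝 (l b)) := by
  classical
  have hK : IsCompact (Set.univ.pi fun _ : S => Set.Icc (-1 : ℝ) 1) :=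
    isCompact_univ_pi fun _ => isCompact_Icc
  obtain ⟨l, -, φ, hφ, hl⟩ := hK.tendsto_subseq (x := fun n (b : S) => a n b) fun n b _ =>
    abs_le.1 (ha n b b.2)
  refine ⟨fun b => if hb : b ∈ S then l ⟨b, hb⟩ else 0, φ, hφ, fun b hb => ?_⟩
  simp only [dif_pos hb]
  exact tendsto_pi_nhds.1 hl ⟨b, hb⟩

open scoped Classical in
/-- Combinations of evaluations of a smooth function near the points `c i`, divided by their
moments, converge. -/
theorem tendsto_sum_div_clusterMoments {q : ℕ} {κ : Type} [Fintype κ] {m : ℕ}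
    {c : κ → EuclideanSpace ℝ (Fin q)} (hm : ∀ v, ({i | c i = v} : Finset κ).card ≤ m + 1)
    {z : ℕ → κ → EuclideanSpace ℝ (Fin q)} (hz : ∀ i, Tendsto (fun n => z n i) atTop (𝓝 (c i)))
    {w : ℕ → κ → ℝ} (hN : ∀ n, 0 < clusterMoments c (z n) (w n))
    {l : (_ : EuclideanSpace ℝ (Fin q)) × (Fin q → ℕ) → ℝ}
    (hl : ∀ v ∈ Finset.univ.image c, ∀ α ∈ multiIndices q ({i | c i = v} : Finset κ).card,
      Tendsto (fun n => (∑ i with c i = v, w n i * shiftedMonomial v α (z n i)) /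
        clusterMoments c (z n) (w n)) atTop (𝓝 (l ⟨v, α⟩)))
    {f : EuclideanSpace ℝ (Fin q) → ℝ} (hf : ∀ i, ContDiffAt ℝ m f (c i)) :
    Tendsto (fun n => (∑ i, w n i * f (z n i)) / clusterMoments c (z n) (w n)) atTop
      (𝓝 (∑ v ∈ Finset.univ.image c, ∑ α ∈ multiIndices q ({i | c i = v} : Finset κ).card,
        multiDeriv α f v / multiFactorial α * l ⟨v, α⟩)) := by
  have hsplit : ∀ n, (∑ i, w n i * f (z n i)) / clusterMoments c (z n) (w n) =
      ∑ v ∈ Finset.univ.image c, (∑ i with c i = v, w n i * f (z n i)) /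
        clusterMoments c (z n) (w n) := by
    intro n
    rw [← Finset.sum_fiberwise_of_maps_to (s := Finset.univ) (t := Finset.univ.image c) (g := c)
      (fun i _ => Finset.mem_image_of_mem c (Finset.mem_univ i)), Finset.sum_div]
  simp only [hsplit]
  refine tendsto_finsetSum _ fun v hv => ?_
  obtain ⟨i₀, -, hi₀⟩ := Finset.mem_image.1 hv
  set F : Finset κ := {i | c i = v} with hF
  have hpos : 0 < F.card := Finset.card_pos.2 ⟨i₀, by simpa [hF] using hi₀⟩
  obtain ⟨m', hm'⟩ : ∃ m', F.card = m' + 1 := ⟨_, (Nat.succ_pred_eq_of_pos hpos).symm⟩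
  have hmm : m' ≤ m := by
    have : F.card ≤ m + 1 := hm v
    omega
  have hfv : ContDiffAt ℝ m' f v := (hi₀ ▸ hf i₀).of_le (by exact_mod_cast hmm)
  set N : ℕ → ℝ := fun n => clusterMoments c (z n) (w n) with hNdef
  set A : ℕ → (Fin q → ℕ) → ℝ := fun n α => ∑ i ∈ F, w n i * shiftedMonomial v α (z n i) with hA
  have hlim : Tendsto (fun n => ∑ α ∈ multiIndices q F.card,
      multiDeriv α f v / multiFactorial α * (A n α / N n)) atTop
      (𝓝 (∑ α ∈ multiIndices q F.card, multiDeriv α f v / multiFactorial α * l ⟨v, α⟩)) :=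
    tendsto_finsetSum _ fun α hα => (hl v hv α hα).const_mul _
  refine hlim.congr_dist ?_
  rw [Metric.tendsto_atTop]
  intro ε hε
  -- The Taylor error of a cluster is relative to the moments of that cluster, which are part of the
  -- normalising sum; this keeps the error small after division.
  obtain ⟨δ, hδ, hδb⟩ := eventually_abs_sum_sub_moments_le hfv (half_pos hε)
  have hev : ∀ᶠ n in atTop, ∀ i, c i = v → dist (z n i) v < δ := by
    refine eventually_all.2 fun i => ?_
    filter_upwards [(hz i).eventually (Metric.ball_mem_nhds _ hδ)] with n hn hi
    rw [← hi]
    exact hn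
  obtain ⟨n₀, hn₀⟩ := eventually_atTop.1 hev
  refine ⟨n₀, fun n hn => ?_⟩
  have h := hδb F hm'.le (z n) (fun i hi => hn₀ n hn i (Finset.mem_filter.1 hi).2) (w n)
  rw [← hm'] at h
  have hNn := hN n
  have hsum : ∑ α ∈ multiIndices q F.card, |A n α| ≤ N n :=
    Finset.single_le_sum (f := fun v => ∑ α ∈ multiIndices q ({i | c i = v} : Finset κ).card,
      |∑ i with c i = v, w n i * shiftedMonomial v α (z n i)|)
      (fun _ _ => Finset.sum_nonneg fun _ _ => abs_nonneg _) hv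
  rw [Real.dist_0_eq_abs, abs_of_nonneg dist_nonneg, dist_comm, Real.dist_eq]
  have h1 : (∑ i ∈ F, w n i * f (z n i)) / N n -
      ∑ α ∈ multiIndices q F.card, multiDeriv α f v / multiFactorial α * (A n α / N n) =
      (∑ i ∈ F, w n i * f (z n i) -
        ∑ α ∈ multiIndices q F.card, multiDeriv α f v / multiFactorial α * A n α) / N n := by
    rw [sub_div, Finset.sum_div (multiIndices q F.card)]
    congr 1
    exact Finset.sum_congr rfl fun α _ => (mul_div_assoc _ _ _).symm
  rw [h1, abs_div, abs_of_pos hNn, div_lt_iff₀ hNn]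
  calc _ ≤ ε / 2 * ∑ α ∈ multiIndices q F.card, |A n α| := h
    _ ≤ ε / 2 * N n := mul_le_mul_of_nonneg_left hsum (half_pos hε).le
    _ < ε * N n := mul_lt_mul_of_pos_right (half_lt_self hε) hNn


-- The normalised moments have absolute sum 1, and so do their subsequential limits `l`. If the L¹
-- norms were of smaller order, the `l ⟨v, α⟩ / multiFactorial α` would be coefficients of a
-- forbidden linear relation.
open scoped Classical in
theorem not_tendsto_of_isLinIndepFamily {q : ℕ} {X : Type*} [MeasurableSpace X] {lam : Measure X}
    {Θ : Set (EuclideanSpace ℝ (Fin q))} {p : X → EuclideanSpace ℝ (Fin q) → ℝ} {m k₀ k : ℕ}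
    (hlin : IsLinIndepFamily lam Θ p m k₀ k) (hp_meas : ∀ θ ∈ Θ, Measurable fun x => p x θ)
    {κ : Type} [Fintype κ] {c : κ → EuclideanSpace ℝ (Fin q)} (hc : ∀ i, c i ∈ Θ)
    (hm : ∀ v, ({i | c i = v} : Finset κ).card ≤ m + 1)
    (hl₁ : k₀ ≤ (Finset.univ.image c).card) (hl₂ : (Finset.univ.image c).card + k₀ ≤ 2 * k)
    (hκ₁ : 2 * k₀ ≤ Fintype.card κ) (hκ₂ : Fintype.card κ ≤ 2 * k)
    {z : ℕ → κ → EuclideanSpace ℝ (Fin q)} (hzΘ : ∀ n i, z n i ∈ Θ)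
    (hz : ∀ i, Tendsto (fun n => z n i) atTop (𝓝 (c i)))
    {w : ℕ → κ → ℝ} (hw : ∀ n, ∑ i, w n i = 0) (hN : ∀ n, 0 < clusterMoments c (z n) (w n)) :
    ¬ Tendsto (fun n => (∫⁻ x, ‖∑ i, w n i * p x (z n i)‖ₑ ∂lam) /
      ENNReal.ofReal (clusterMoments c (z n) (w n))) atTop (𝓝 0) := by
  intro hT
  set V := Finset.univ.image c with hV
  set N : ℕ → ℝ := fun n => clusterMoments c (z n) (w n) with hNdef
  set μ : EuclideanSpace ℝ (Fin q) → ℕ := fun v => ({i | c i = v} : Finset κ).card with hμ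
  set S : Finset ((_ : EuclideanSpace ℝ (Fin q)) × (Fin q → ℕ)) :=
    V.sigma fun v => multiIndices q (μ v) with hS
  set a : ℕ → (_ : EuclideanSpace ℝ (Fin q)) × (Fin q → ℕ) → ℝ := fun n b =>
    (∑ i with c i = b.1, w n i * shiftedMonomial b.1 b.2 (z n i)) / N n with ha
  have hsumS : ∀ n, ∑ b ∈ S, |a n b| = 1 := by
    intro n
    rw [hS, Finset.sum_sigma]
    have hNn : |N n| = N n := abs_of_pos (hN n)
    simp only [ha, abs_div, hNn, ← Finset.sum_div]
    exact div_self (hN n).ne'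
  obtain ⟨l, φ, hφ, hl⟩ := exists_subseq_tendsto_of_abs_le_one S a fun n b hb => by
    rw [← hsumS n]
    exact Finset.single_le_sum (f := fun b => |a n b|) (fun _ _ => abs_nonneg _) hb
  have hl1 : ∑ b ∈ S, |l b| = 1 := by
    have h1 : Tendsto (fun n => ∑ b ∈ S, |a (φ n) b|) atTop (𝓝 (∑ b ∈ S, |l b|)) :=
      tendsto_finsetSum _ fun b hb => (hl b hb).abs
    simp only [hsumS] at h1
    exact (tendsto_nhds_unique h1 tendsto_const_nhds)
  have hlim : ∀ {f : EuclideanSpace ℝ (Fin q) → ℝ}, (∀ i, ContDiffAt ℝ m f (c i)) →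
      Tendsto (fun n => (∑ i, w (φ n) i * f (z (φ n) i)) / N (φ n)) atTop
      (𝓝 (∑ v ∈ V, ∑ α ∈ multiIndices q (μ v), multiDeriv α f v / multiFactorial α * l ⟨v, α⟩)) :=
    fun hf => tendsto_sum_div_clusterMoments hm (z := fun n => z (φ n)) (w := fun n => w (φ n))
      (fun i => (hz i).comp hφ.tendsto_atTop) (fun n => hN _)
      (fun v hv α hα => hl ⟨v, α⟩ (Finset.mem_sigma.2 ⟨hv, hα⟩)) hf
  have hzero : ∀ᵐ x ∂lam, ∑ v ∈ V, ∑ α ∈ multiIndices q (μ v),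
      multiDeriv α (p x) v / multiFactorial α * l ⟨v, α⟩ = 0 := by
    have hmeas : ∀ n, Measurable fun x => ‖(∑ i, w (φ n) i * p x (z (φ n) i)) / N (φ n)‖ₑ :=
      fun n => ((Finset.measurable_fun_sum _ fun i _ =>
        (hp_meas _ (hzΘ _ i)).const_mul _).div_const _).enorm
    -- Fatou's lemma needs no domination of the derivatives of `p`: the integral of the lower limit
    -- is 0, and the pointwise limit is the combination of derivatives.
    have hF := lintegral_liminf_le (μ := lam) (u := atTop) hmeas
    have h0 : liminf (fun n => ∫⁻ x, ‖(∑ i, w (φ n) i * p x (z (φ n) i)) / N (φ n)‖ₑ ∂lam) atTop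
        = 0 := by
      refine Tendsto.liminf_eq ((hT.comp hφ.tendsto_atTop).congr fun n => ?_)
      simp only [Function.comp, div_eq_mul_inv, enorm_mul]
      rw [lintegral_mul_const', ← Real.enorm_of_nonneg (hN (φ n)).le, enorm_inv (hN (φ n)).ne']
      exact enorm_ne_top
    rw [h0, nonpos_iff_eq_zero, lintegral_eq_zero_iff (Measurable.liminf hmeas)] at hF
    filter_upwards [hF, hlin.contDiff] with x hx hcd
    have h1 := (hlim (f := p x) fun i => hcd _ (hc i)).enorm.liminf_eq
    simp only [Pi.zero_apply] at hx
    rw [hx] at h1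
    exact enorm_eq_zero.1 h1.symm
  -- The moments of order 0 add up to the total weight, which is 0; this is the additional condition
  -- in the linear independence hypothesis.
  have hzero' : ∑ v ∈ V, l ⟨v, 0⟩ = 0 := by
    have h1 : Tendsto (fun n => ∑ v ∈ V, a (φ n) ⟨v, 0⟩) atTop (𝓝 (∑ v ∈ V, l ⟨v, 0⟩)) := by
      refine tendsto_finsetSum _ fun v hv => hl _ (Finset.mem_sigma.2 ⟨hv, mem_multiIndices.2 ?_⟩)
      obtain ⟨i, -, hi⟩ := Finset.mem_image.1 hv
      simpa [hμ] using Finset.card_pos.2 ⟨i, by simpa using hi⟩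
    refine tendsto_nhds_unique h1 ?_
    refine tendsto_const_nhds.congr fun n => ?_
    simp only [ha, ← Finset.sum_div]
    have h2 : ∀ v y, shiftedMonomial (q := q) v 0 y = 1 := fun v y => by simp [shiftedMonomial]
    simp only [h2, mul_one]
    rw [Finset.sum_fiberwise_of_maps_to (s := Finset.univ) (t := V) (g := c)
      (fun i _ => Finset.mem_image_of_mem c (Finset.mem_univ i)), hw, zero_div]
  have hμpos : ∀ v ∈ V, 1 ≤ μ v := by
    intro v hv
    obtain ⟨i, -, hi⟩ := Finset.mem_image.1 hv
    exact Finset.card_pos.2 ⟨i, by simpa using hi⟩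
  have hμsum : ∑ v ∈ V, μ v = Fintype.card κ :=
    (Finset.card_eq_sum_card_fiberwise (s := Finset.univ) (t := V) (f := c)
      fun i _ => Finset.mem_image_of_mem c (Finset.mem_univ i)).symm
  set e := V.equivFin with he
  set θ : Fin V.card → EuclideanSpace ℝ (Fin q) := fun i => (e.symm i : V) with hθ
  have hθsum : ∀ {β : Type} [AddCommMonoid β] (F : EuclideanSpace ℝ (Fin q) → β),
      ∑ i, F (θ i) = ∑ v ∈ V, F v := by
    intro β _ F
    rw [← Finset.sum_coe_sort V]
    exact Equiv.sum_comp e.symm fun v : V => F v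
  have hall := (hlin.linIndep V.card hl₁ hl₂ (fun i => μ (θ i))
    (fun i => ⟨hμpos _ (e.symm i).2, hm _⟩) (by rw [hθsum μ, hμsum]; exact hκ₁)
    (by rw [hθsum μ, hμsum]; exact hκ₂) θ
    (fun i j hij => e.symm.injective (Subtype.ext hij))
    (fun i => by
      obtain ⟨j, -, hj⟩ := Finset.mem_image.1 (e.symm i).2
      show ((e.symm i : V) : EuclideanSpace ℝ (Fin q)) ∈ Θ
      rw [← hj]
      exact hc j)
    (fun i α => l ⟨θ i, α⟩ / multiFactorial α)).1 ⟨?_, ?_⟩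
  · have hlS : ∀ b ∈ S, |l b| = 0 := by
      rintro ⟨v, α⟩ hb
      obtain ⟨hv, hα⟩ := Finset.mem_sigma.1 hb
      have hθv : θ (e ⟨v, hv⟩) = v := by simp [hθ]
      have h := hall (e ⟨v, hv⟩) α (by rw [hθv]; exact hα)
      rw [hθv, div_eq_zero_iff] at h
      rw [abs_eq_zero]
      exact h.resolve_right (multiFactorial_pos α).ne'
    rw [Finset.sum_eq_zero hlS] at hl1
    exact zero_ne_one hl1
  · filter_upwards [hzero] with x hx
    rw [← hx, hθsum fun v => ∑ α ∈ multiIndices q (μ v),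
      l ⟨v, α⟩ / multiFactorial α * multiDeriv α (p x) v]
    exact Finset.sum_congr rfl fun v _ => Finset.sum_congr rfl fun α _ => by ring
  · rw [hθsum fun v => l ⟨v, 0⟩ / multiFactorial 0]
    simp [multiFactorial, hzero']

/-! ### Counting limit points and the contradiction -/

/-- The sizes of the fibres of a map on `2 * k` points, all of whose values in a set of `k₀` points
are taken at least twice. -/
theorem card_fiber_bounds {κ β : Type*} [Fintype κ] [DecidableEq β] {c : κ → β} {S : Finset β}
    {k k₀ : ℕ} (hκ : Fintype.card κ = 2 * k) (hS : S.card = k₀)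
    (hS2 : ∀ v ∈ S, 2 ≤ ({i | c i = v} : Finset κ).card) (hk₀ : 1 ≤ k₀) (hk : k₀ ≤ k) :
    (∀ v, ({i | c i = v} : Finset κ).card ≤ 2 * (k - k₀ + 1)) ∧
      k₀ ≤ (Finset.univ.image c).card ∧ (Finset.univ.image c).card + k₀ ≤ 2 * k := by
  set V := Finset.univ.image c with hV
  have hpos : ∀ v ∈ V, 1 ≤ ({i | c i = v} : Finset κ).card := by
    intro v hv
    obtain ⟨i, -, hi⟩ := Finset.mem_image.1 hv
    exact Finset.card_pos.2 ⟨i, by simpa using hi⟩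
  have hsum : ∑ v ∈ V, ({i | c i = v} : Finset κ).card = 2 * k := by
    rw [← hκ]
    exact (Finset.card_eq_sum_card_fiberwise (s := Finset.univ) (t := V) (f := c)
      fun i _ => Finset.mem_image_of_mem c (Finset.mem_univ i)).symm
  have hSV : S ⊆ V := by
    intro v hv
    obtain ⟨i, hi⟩ := Finset.card_pos.1 (lt_of_lt_of_le two_pos (hS2 v hv))
    rw [← (Finset.mem_filter.1 hi).2]
    exact Finset.mem_image_of_mem c (Finset.mem_univ i)
  refine ⟨fun v => ?_, hS ▸ Finset.card_le_card hSV, ?_⟩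
  · have h1 : ∀ T ⊆ S, v ∉ T → v ∈ V → ({i | c i = v} : Finset κ).card + 2 * T.card ≤ 2 * k := by
      intro T hT hvT hvV
      rw [← hsum, ← Finset.add_sum_erase V _ hvV]
      refine add_le_add le_rfl ?_
      rw [mul_comm, ← smul_eq_mul]
      refine (Finset.card_nsmul_le_sum T _ 2 fun u hu => hS2 u (hT hu)).trans
        (Finset.sum_le_sum_of_subset fun u hu => ?_)
      exact Finset.mem_erase.2 ⟨fun h => hvT (h ▸ hu), hSV (hT hu)⟩
    by_cases hvV : v ∈ V
    · by_cases hvS : v ∈ S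
      · have := h1 (S.erase v) (Finset.erase_subset _ _) (Finset.notMem_erase _ _) hvV
        rw [Finset.card_erase_of_mem hvS] at this
        omega
      · have := h1 S subset_rfl hvS hvV
        omega
    · have : ({i | c i = v} : Finset κ) = ∅ := by
        rw [Finset.filter_eq_empty_iff]
        intro i _ hi
        exact hvV (hi ▸ Finset.mem_image_of_mem c (Finset.mem_univ i))
      rw [this]
      simp
  · rw [← hsum, ← Finset.sum_sdiff hSV, ← Finset.card_sdiff_add_card_eq_card hSV, add_assoc]
    refine add_le_add ?_ ?_
    · rw [Finset.card_eq_sum_ones]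
      exact Finset.sum_le_sum fun v hv => hpos v (Finset.mem_sdiff.1 hv).1
    · have := Finset.card_nsmul_le_sum S _ 2 hS2
      rw [smul_eq_mul] at this
      omega

/-- Raising `k₀` shrinks the ranges of `l` and of the total multiplicity, and lowering `m` restricts
the multiplicities. This reduces part (b) to part (a). -/
theorem IsLinIndepFamily.mono {q : ℕ} {X : Type*} [MeasurableSpace X] {lam : Measure X}
    {Θ : Set (EuclideanSpace ℝ (Fin q))} {p : X → EuclideanSpace ℝ (Fin q) → ℝ}
    {m m' k₀ k₀' k : ℕ} (hm : m' ≤ m) (hk : k₀ ≤ k₀') (h : IsLinIndepFamily lam Θ p m k₀ k) :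
    IsLinIndepFamily lam Θ p m' k₀' k where
  contDiff := by
    filter_upwards [h.contDiff] with x hx θ hθ
    exact (hx θ hθ).of_le (by exact_mod_cast hm)
  linIndep l h1 h2 mult h3 h4 h5 := h.linIndep l (hk.trans h1) (by omega) mult
    (fun i => ⟨(h3 i).1, (h3 i).2.trans (by omega)⟩) (by omega) h5

theorem exists_bound_of_isLinIndepFamily {q : ℕ} {X : Type*} [MeasurableSpace X] {lam : Measure X}
    {Θ : Set (EuclideanSpace ℝ (Fin q))} (hΘ : IsCompact Θ)
    {P : EuclideanSpace ℝ (Fin q) → Measure X} (hP : ∀ θ ∈ Θ, IsProbabilityMeasure (P θ))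
    {p : X → EuclideanSpace ℝ (Fin q) → ℝ}
    (hp_meas : ∀ θ ∈ Θ, Measurable fun x => p x θ)
    (hp_nonneg : ∀ θ ∈ Θ, ∀ x, 0 ≤ p x θ)
    (hp_density : ∀ θ ∈ Θ, P θ = lam.withDensity fun x => ENNReal.ofReal (p x θ))
    {k k₀ : ℕ} (hk₀ : 1 ≤ k₀) (hk : k₀ ≤ k)
    (hlin : IsLinIndepFamily lam Θ p (2 * (k - k₀ + 1) - 1) k₀ k)
    {G₀ : MixingMeasure q} (hG₀ : G₀ ∈ exactlyAtoms Θ k₀) :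
    ∃ ε > 0, ∀ G ∈ atMostAtoms Θ k, ∀ H ∈ atMostAtoms Θ k, G ≠ H →
      wasserstein 1 G G₀ < ε → wasserstein 1 H G₀ < ε →
      ε ≤ totalVariationDist (mixture P G) (mixture P H) /
        wasserstein (2 * (k - k₀ + 1) - 1) G H ^ (2 * (k - k₀ + 1) - 1) := by
  classical
  set r := 2 * (k - k₀ + 1) - 1 with hr
  have hr1 : 1 ≤ r := by omega
  by_contra! hcon
  choose G hG H hH hne hGW hHW hV using fun n : ℕ =>
    hcon (1 / ((n : ℝ) + 1)) Nat.one_div_pos_of_nat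
  have hlim1 : Tendsto (fun n : ℕ => 1 / ((n : ℝ) + 1)) atTop (𝓝 0) :=
    tendsto_one_div_add_atTop_nhds_zero_nat
  choose zG wG hzG hzG' hwG using fun n => (G n).exists_enum (hG n).2
  choose zH wH hzH hzH' hwH using fun n => (H n).exists_enum (hH n).2
  -- The atoms of `G n` and, with negative weights, those of `H n`, padded to exactly `2 * k`
  -- points.
  set z : ℕ → Fin k ⊕ Fin k → EuclideanSpace ℝ (Fin q) := fun n => Sum.elim (zG n) (zH n) with hzdef
  set w : ℕ → Fin k ⊕ Fin k → ℝ := fun n => Sum.elim (wG n) (-wH n) with hwdef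
  have hrep : ∀ n (F : EuclideanSpace ℝ (Fin q) → ℝ), ∑ i, w n i * F (z n i) =
      ∑ θ ∈ (G n).weights.support, (G n).weights θ * F θ -
        ∑ θ ∈ (H n).weights.support, (H n).weights θ * F θ := by
    intro n F
    rw [← hwG, ← hwH]
    simp [hzdef, hwdef, Fintype.sum_sum_type, sub_eq_add_neg]
  have hzmem : ∀ n i, z n i ∈ (G n).weights.support ∪ (H n).weights.support := by
    rintro n (i | i)
    · exact Finset.mem_union_left _ (hzG n i)
    · exact Finset.mem_union_right _ (hzH n i)
  have hsuppΘ : ∀ n, ∀ x ∈ (G n).weights.support ∪ (H n).weights.support, x ∈ Θ := by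
    intro n x hx
    rcases Finset.mem_union.1 hx with hx | hx
    · exact (hG n).1 x hx
    · exact (hH n).1 x hx
  obtain ⟨c, hcΘ, φ, hφ, hc⟩ := (isCompact_univ_pi fun _ : Fin k ⊕ Fin k => hΘ).tendsto_subseq
    (x := z) fun n i _ => hsuppΘ n _ (hzmem n i)
  have hzc : ∀ i, Tendsto (fun n => z (φ n) i) atTop (𝓝 (c i)) := tendsto_pi_nhds.1 hc
  have hφ1 : Tendsto (fun n => 1 / ((φ n : ℝ) + 1)) atTop (𝓝 0) := hlim1.comp hφ.tendsto_atTop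
  -- every atom of `G₀` is the limit of atoms
  have hatom : ∀ {K : ℕ → MixingMeasure q} {ψ : Fin k → Fin k ⊕ Fin k},
      (∀ n, wasserstein 1 (K n) G₀ < 1 / ((n : ℝ) + 1)) →
      (∀ n, ∀ θ ∈ (K n).weights.support, ∃ i, z n (ψ i) = θ) →
      ∀ v ∈ G₀.weights.support, ∃ i, c (ψ i) = v := by
    intro K ψ hK hψ v hv
    -- Otherwise the atoms of the measures stay at a distance `δ` from `v`, and moving the mass of
    -- `G₀` at `v` costs at least `G₀.weights v * δ`.
    by_contra! hcv
    have hev : ∃ δ > 0, ∀ᶠ n in atTop, ∀ i, δ ≤ dist (z (φ n) (ψ i)) v := by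
      obtain ⟨δ, hδ, hδ'⟩ : ∃ δ > 0, ∀ i, δ < dist (c (ψ i)) v := by
        rcases isEmpty_or_nonempty (Fin k) with h | h
        · exact ⟨1, one_pos, fun i => h.elim i⟩
        · obtain ⟨i₀, hi₀⟩ := Finite.exists_min fun i => dist (c (ψ i)) v
          exact ⟨dist (c (ψ i₀)) v / 2, half_pos (dist_pos.2 (hcv i₀)), fun i =>
            (half_lt_self (dist_pos.2 (hcv i₀))).trans_le (hi₀ i)⟩
      refine ⟨δ, hδ, eventually_all.2 fun i => ?_⟩
      filter_upwards [((hzc (ψ i)).dist tendsto_const_nhds).eventually (lt_mem_nhds (hδ' i))]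
        with n hn using hn.le
    obtain ⟨δ, hδ, hev⟩ := hev
    have hpos : 0 < G₀.weights v * δ :=
      mul_pos (lt_of_le_of_ne (G₀.weights_nonneg v) (Finsupp.mem_support_iff.1 hv).symm) hδ
    obtain ⟨n, hn1, hn2⟩ := (hev.and (hφ1.eventually (gt_mem_nhds hpos))).exists
    obtain ⟨η, hη, hηv⟩ := exists_atom_near hv hδ ((hK (φ n)).trans hn2)
    obtain ⟨i, rfl⟩ := hψ (φ n) η hη
    exact absurd hηv (not_lt.2 (hn1 i))
  have htwo : ∀ v ∈ G₀.weights.support, 2 ≤ ({i | c i = v} : Finset (Fin k ⊕ Fin k)).card := by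
    intro v hv
    obtain ⟨i, hi⟩ := hatom (ψ := Sum.inl) hGW hzG' v hv
    obtain ⟨j, hj⟩ := hatom (ψ := Sum.inr) hHW hzH' v hv
    rw [← Finset.card_pair (Sum.inl_ne_inr (a := i) (b := j))]
    refine Finset.card_le_card fun x hx => ?_
    rcases Finset.mem_insert.1 hx with rfl | hx
    · simpa using hi
    · rw [Finset.mem_singleton] at hx
      subst hx
      simpa using hj
  have hκ : Fintype.card (Fin k ⊕ Fin k) = 2 * k := by simp [two_mul]
  obtain ⟨hm, hl₁, hl₂⟩ := card_fiber_bounds hκ hG₀.2 htwo hk₀ hk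
  have hm' : ∀ v, ({i | c i = v} : Finset (Fin k ⊕ Fin k)).card ≤ r + 1 := fun v =>
    (hm v).trans (by omega)
  -- the Wasserstein distance is controlled by the moments
  obtain ⟨C₁, hC₁, hC₁b⟩ := exists_pow_mul_abs_sum_le_clusterMoments c (2 * k) r
    (fun v => by convert hm' v)
  obtain ⟨R, hR⟩ := Metric.isBounded_iff.1 hΘ.isBounded
  obtain ⟨C₂, hC₂, hC₂b⟩ := exists_wasserstein_pow_le q (2 * k) r hr1 R
  have hcard : ∀ n, ((G n).weights.support ∪ (H n).weights.support).card ≤ 2 * k := fun n =>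
    (Finset.card_union_le _ _).trans (by have := (hG n).2; have := (hH n).2; omega)
  have hclose : ∀ᶠ n in atTop, ∀ i j, |z (φ n) i j - c i j| ≤ 1 := by
    refine eventually_all.2 fun i => ?_
    filter_upwards [(hzc i).eventually (Metric.ball_mem_nhds _ one_pos)] with n hn j
    have h2 := PiLp.norm_apply_le (z (φ n) i - c i) j
    rw [← dist_eq_norm] at h2
    simpa using h2.trans (Metric.mem_ball.1 hn).le
  have hWN : ∀ᶠ n in atTop, wasserstein r (G (φ n)) (H (φ n)) ^ r ≤
      C₂ * C₁ * clusterMoments c (z (φ n)) (w (φ n)) := by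
    filter_upwards [hclose] with n hn
    rw [mul_assoc]
    refine hC₂b _ _ (by convert hcard (φ n)) (fun θ hθ η hη => hR ((hG _).1 θ hθ) ((hH _).1 η hη)) _
      (mul_nonneg hC₁ (clusterMoments_nonneg _ _ _)) fun s hs hs1 U hU hsep => ?_
    have h := hC₁b (z (φ n)) hn s hs hs1 U
      ((Finset.card_le_card hU).trans (by convert hcard (φ n)))
      (fun i hi => hsep _ (by convert hzmem (φ n) i) hi) (w (φ n))
    rwa [hrep (φ n)] at h
  obtain ⟨n₀, hn₀⟩ := eventually_atTop.1 hWN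
  have hWpos : ∀ n, 0 < wasserstein r (G n) (H n) ^ r := fun n =>
    wasserstein_pow_pos (by omega) (hne n)
  have hC : 0 ≤ C₂ * C₁ := mul_nonneg hC₂ hC₁
  -- Distinct measures have positive Wasserstein distance, so the moments that bound it cannot all
  -- vanish.
  have hNpos : ∀ n, 0 < clusterMoments c (z (φ (n + n₀))) (w (φ (n + n₀))) := fun n =>
    pos_of_mul_pos_right ((hWpos _).trans_le (hn₀ (n + n₀) (Nat.le_add_left _ _))) hC
  refine not_tendsto_of_isLinIndepFamily hlin hp_meas (c := c) (z := fun n => z (φ (n + n₀)))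
    (w := fun n => w (φ (n + n₀))) (fun i => hcΘ i (Set.mem_univ i)) (fun v => by convert hm' v)
    (by convert hl₁) (by convert hl₂)
    (by omega) hκ.le (fun n i => hsuppΘ _ _ (hzmem _ i))
    (fun i => (hzc i).comp (tendsto_add_atTop_nat n₀)) (fun n => ?_) hNpos ?_
  · have h := hrep (φ (n + n₀)) fun _ => 1
    simpa [MixingMeasure.sum_weights] using h
  -- The L¹ norm is at most twice the total variation, which is less than `1 / (φ (n + n₀) + 1)`
  -- times the power of the Wasserstein distance, itself at most `C₂ * C₁` times the moments.
  · have hlim2 : Tendsto (fun n => ENNReal.ofReal (2 * (C₂ * C₁) *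
        (1 / ((φ (n + n₀) : ℝ) + 1)))) atTop (𝓝 0) := by
      have := ENNReal.tendsto_ofReal ((hφ1.comp (tendsto_add_atTop_nat n₀)).const_mul
        (2 * (C₂ * C₁)))
      simpa using this
    refine tendsto_of_tendsto_of_tendsto_of_le_of_le tendsto_const_nhds hlim2
      (fun _ => zero_le) fun n => ?_
    have hN := hNpos n
    refine ENNReal.div_le_of_le_mul ?_
    rw [← ENNReal.ofReal_mul (by positivity)]
    have h := lintegral_enorm_mixture_sub_le hP hp_meas hp_nonneg hp_density
      (hG (φ (n + n₀))).1 (hH (φ (n + n₀))).1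
    simp only [← hrep] at h
    refine h.trans (ENNReal.ofReal_le_ofReal ?_)
    have h1 := hV (φ (n + n₀))
    rw [div_lt_iff₀ (hWpos _)] at h1
    have h2 := hn₀ (n + n₀) (Nat.le_add_left _ _)
    have h3 : (0 : ℝ) ≤ 1 / ((φ (n + n₀) : ℝ) + 1) := by positivity
    have h4 := mul_le_mul_of_nonneg_left h2 h3
    linarith

theorem localInverseBound_of_isLinIndepFamily {q : ℕ} {X : Type*} [MeasurableSpace X]
    {lam : Measure X} {Θ : Set (EuclideanSpace ℝ (Fin q))} (hΘ : IsCompact Θ)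
    {P : EuclideanSpace ℝ (Fin q) → Measure X} (hP : ∀ θ ∈ Θ, IsProbabilityMeasure (P θ))
    {p : X → EuclideanSpace ℝ (Fin q) → ℝ}
    (hp_meas : ∀ θ ∈ Θ, Measurable fun x => p x θ)
    (hp_nonneg : ∀ θ ∈ Θ, ∀ x, 0 ≤ p x θ)
    (hp_density : ∀ θ ∈ Θ, P θ = lam.withDensity fun x => ENNReal.ofReal (p x θ))
    {k k₀ : ℕ} (hk₀ : 1 ≤ k₀) (hk : k₀ ≤ k)
    (hlin : IsLinIndepFamily lam Θ p (2 * (k - k₀ + 1) - 1) k₀ k)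
    {G₀ : MixingMeasure q} (hG₀ : G₀ ∈ exactlyAtoms Θ k₀) :
    LocalInverseBound Θ P k (2 * (k - k₀ + 1) - 1) G₀ := by
  obtain ⟨ε, hε, h⟩ := exists_bound_of_isLinIndepFamily hΘ hP hp_meas hp_nonneg hp_density hk₀ hk
    hlin hG₀
  refine lt_of_lt_of_le (b := (ε : EReal)) (by exact_mod_cast hε) (le_liminf_of_le ?_ ?_)
  · isBoundedDefault
  have h1 : ∀ᶠ GH : MixingMeasure q × MixingMeasure q in
      comap (fun GH => (wasserstein 1 GH.1 G₀, wasserstein 1 GH.2 G₀)) (𝓝 (0, 0)),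
      wasserstein 1 GH.1 G₀ < ε ∧ wasserstein 1 GH.2 G₀ < ε := by
    refine Eventually.comap (p := fun x : ℝ × ℝ => x.1 < ε ∧ x.2 < ε) ?_ _
    rw [nhds_prod_eq]
    exact (gt_mem_nhds hε).prod_mk (gt_mem_nhds hε)
  filter_upwards [h1.filter_mono inf_le_left,
    Eventually.filter_mono inf_le_right (eventually_principal.2 fun _ hGH => hGH)] with GH hW hGH
  exact_mod_cast h GH.1 hGH.1 GH.2 hGH.2.1 hGH.2.2 hW.1 hW.2

end

theorem theorem9 {q : ℕ} {X : Type*} [MeasurableSpace X] (lam : Measure X)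
    (Θ : Set (EuclideanSpace ℝ (Fin q))) (hΘ : IsCompact Θ)
    (P : EuclideanSpace ℝ (Fin q) → Measure X) (hP : ∀ θ ∈ Θ, IsProbabilityMeasure (P θ))
    (p : X → EuclideanSpace ℝ (Fin q) → ℝ)
    (hp_meas : ∀ θ ∈ Θ, Measurable fun x => p x θ)
    (hp_nonneg : ∀ θ ∈ Θ, ∀ x, 0 ≤ p x θ)
    (hp_density : ∀ θ ∈ Θ, P θ = lam.withDensity fun x => ENNReal.ofReal (p x θ))
    (k : ℕ) :
    (∀ k₀ : ℕ, 1 ≤ k₀ → k₀ ≤ k →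
      IsLinIndepFamily lam Θ p (2 * (k - k₀ + 1) - 1) k₀ k →
      ∀ G₀ ∈ exactlyAtoms Θ k₀, LocalInverseBound Θ P k (2 * (k - k₀ + 1) - 1) G₀) ∧
    (IsLinIndepFamily lam Θ p (2 * k - 1) 1 k →
      ∀ k₀ : ℕ, 1 ≤ k₀ → k₀ ≤ k →
      ∀ G₀ ∈ exactlyAtoms Θ k₀, LocalInverseBound Θ P k (2 * (k - k₀ + 1) - 1) G₀) := by
  refine ⟨fun k₀ hk₀ hk hlin G₀ hG₀ => localInverseBound_of_isLinIndepFamily hΘ hP hp_meas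
    hp_nonneg hp_density hk₀ hk hlin hG₀, fun hlin k₀ hk₀ hk G₀ hG₀ =>
    localInverseBound_of_isLinIndepFamily hΘ hP hp_meas hp_nonneg hp_density hk₀ hk
      (hlin.mono (by omega) hk₀) hG₀⟩
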